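/- Let $X\subset\mathbb R^d$ be a compact set of positive Lebesgue measure, and let $\mathrm{Leb}$ denote the Lebesgue measure restricted to $X$ and normalized to have mass $1$. Let $\mathbb M=L^2(X,\mathbb R^d)$ be equipped with the norm $\|m\|^2=\int_X|m|^2\,d\mathrm{Leb}$, let $\mathbb S\subset\mathbb M$ be the set of maps $s$ with $s\#\mathrm{Leb}=\mathrm{Leb}$, and put $d^2_{\mathbb S}(m)=\inf_{s\in\mathbb S}\|m-s\|^2$. Let $(P_j)_{1\le j\le N}$ be a partition of $X$ into $N$ measurable regions with $\mathrm{Leb}(P_j)=1/N$ (overlaps of measure zero are allowed), let $\mathbb M_N\subset\mathbb M$ be the finite-dimensional Hilbert subspace of the maps that are (almost everywhere) constant on each $P_j$, and let $\mathbb D_N\subset\mathbb M_N$ be the set of those $m$ with $m(P_j)=m(P_k)$ for some $j\ne k$. Then the restriction of $d^2_{\mathbb S}$ to $\mathbb M_N$ is differentiable at almost every point of $\mathbb M_N$ (for the Lebesgue measure of $\mathbb M_N$), the set $\mathbb M_N\setminus\mathbb D_N$ is open in $\mathbb M_N$, and $d^2_{\mathbb S}$ is continuously differentiable on it. Moreover,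 let $m\in\mathbb M_N\setminus\mathbb D_N$ and write $x_j=m(P_j)$. Then there is an optimal transport map $T:X\to\{x_1,\dots,x_N\}$ from $\mathrm{Leb}$ to $m\#\mathrm{Leb}=\frac1N\sum_j\delta_{x_j}$ for the quadratic cost, that is, a measurable map with $T\#\mathrm{Leb}=m\#\mathrm{Leb}$ whose cost $\int_X|y-T(y)|^2\,d\mathrm{Leb}(y)$ is minimal among the costs of all transport plans between the two measures; it is unique up to equality almost everywhere, and the gradient of $d^2_{\mathbb S}|_{\mathbb M_N}$ at $m$, for the scalar product of $L^2(X,\mathbb R^d)$, is the element of $\mathbb M_N$ given by $$\nabla d^2_{\mathbb S}(m)\big|_{P_j}=2\bigl(x_j-\mathrm{bary}(T^{-1}(x_j))\bigr)\qquad(1\le j\le N),$$ where $\mathrm{bary}(S)=\frac{1}{\mathrm{Leb}(S)}\int_S y\,d\mathrm{Leb}(y)$ is the isobarycenter of $S$. -/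

import Mathlib

open MeasureTheory
open scoped ENNReal

noncomputable section

namespace VolPres

/-- The Euclidean space `ℝ^d`. -/
abbrev E (d : ℕ) : Type := EuclideanSpace ℝ (Fin d)

/-- The Lebesgue measure restricted to `X` and normalized to have mass one. -/
def leb {d : ℕ} (X : Set (E d)) : Measure (E d) :=
  (volume X)⁻¹ • volume.restrict X

/-- The Hilbert space `𝕄 = L²(X, ℝ^d)`, for the normalized Lebesgue measure on `X`. -/
abbrev LTwo {d : ℕ} (X : Set (E d)) : Type := Lp (E d) 2 (leb X)

/-- The set `𝕊 ⊆ 𝕄` of the maps that preserve the normalized Lebesgue measure on `X`. -/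
def mpMaps {d : ℕ} (X : Set (E d)) : Set (LTwo X) :=
  {s | MeasurePreserving (s : E d → E d) (leb X) (leb X)}

/-- The squared distance `d²_𝕊(m) = inf_{s ∈ 𝕊} ‖m - s‖²`. -/
def distSq {d : ℕ} (X : Set (E d)) (m : LTwo X) : ℝ :=
  ⨅ s : mpMaps X, ‖m - (s : LTwo X)‖ ^ 2

/-- A partition of `X` into `N` regions of equal area `1 / N`. Overlaps of measure zero (for
instance common faces of closed cells) are allowed. -/
structure EquiPartition {d : ℕ} (X : Set (E d)) (N : ℕ) where
  cell : Fin N → Set (E d)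
  measurableSet_cell : ∀ j, MeasurableSet (cell j)
  iUnion_cell : ⋃ j, cell j = X
  aedisjoint : Pairwise fun j k => AEDisjoint volume (cell j) (cell k)
  leb_cell : ∀ j, leb X (cell j) = (N : ℝ≥0∞)⁻¹

/-- `m` is (almost everywhere) equal to the constant `v` on the `j`-th cell: `m(P_j) = v`. -/
def HasValueOn {d N : ℕ} {X : Set (E d)} (P : EquiPartition X N) (m : LTwo X) (j : Fin N)
    (v : E d) : Prop :=
  ∀ᵐ y ∂((leb X).restrict (P.cell j)), m y = v

/-- The subspace `𝕄_N ⊆ 𝕄` of the maps that are constant on each cell of the partition. -/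
def stepMaps {d N : ℕ} {X : Set (E d)} (P : EquiPartition X N) : Submodule ℝ (LTwo X) where
  carrier := {m | ∀ j, ∃ v, HasValueOn P m j v}
  zero_mem' := fun j => ⟨0, ae_restrict_of_ae (by
    filter_upwards [Lp.coeFn_zero (E d) 2 (leb X)] with y hy
    simpa using hy)⟩
  add_mem' := by
    intro f g hf hg j
    obtain ⟨v, hv⟩ := hf j
    obtain ⟨w, hw⟩ := hg j
    refine ⟨v + w, ?_⟩
    filter_upwards [hv, hw, ae_restrict_of_ae (Lp.coeFn_add f g)] with y h1 h2 h3
    rw [h3, Pi.add_apply, h1, h2]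
  smul_mem' := by
    intro c f hf j
    obtain ⟨v, hv⟩ := hf j
    refine ⟨c • v, ?_⟩
    filter_upwards [hv, ae_restrict_of_ae (Lp.coeFn_smul c f)] with y h1 h2
    rw [h2, Pi.smul_apply, h1]

lemma leb_cell_ne_top {d N : ℕ} {X : Set (E d)} (P : EquiPartition X N) (j : Fin N) :
    leb X (P.cell j) ≠ ∞ := by
  rw [P.leb_cell j]
  have : NeZero N := ⟨fun h => by subst h; exact j.elim0⟩
  simp [NeZero.ne N]

lemma leb_cell_ne_zero {d N : ℕ} {X : Set (E d)} (P : EquiPartition X N) (j : Fin N) :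
    leb X (P.cell j) ≠ 0 := by
  rw [P.leb_cell j]
  simp

lemma integrable_cell {d N : ℕ} {X : Set (E d)} (P : EquiPartition X N) (j : Fin N)
    (m : LTwo X) : IntegrableOn (m : E d → E d) (P.cell j) (leb X) :=
  integrableOn_Lp_of_measure_ne_top m (by norm_num) (leb_cell_ne_top P j)

/-- The cell integrals, as a linear map on `𝕄_N`. -/
def cellIntegral {d N : ℕ} {X : Set (E d)} (P : EquiPartition X N) :
    stepMaps P →ₗ[ℝ] (Fin N → E d) where
  toFun m j := ∫ y in P.cell j, (m : LTwo X) y ∂(leb X)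
  map_add' := by
    intro f g
    ext1 j
    rw [Pi.add_apply, ← integral_add (integrable_cell P j f) (integrable_cell P j g)]
    exact integral_congr_ae (ae_restrict_of_ae (Lp.coeFn_add (f : LTwo X) (g : LTwo X)))
  map_smul' := by
    intro c f
    ext1 j
    rw [Pi.smul_apply, RingHom.id_apply, ← integral_smul]
    exact integral_congr_ae (ae_restrict_of_ae (Lp.coeFn_smul c (f : LTwo X)))

lemma cellIntegral_injective {d N : ℕ} {X : Set (E d)} (P : EquiPartition X N) :
    Function.Injective (cellIntegral P) := by
  rw [← LinearMap.ker_eq_bot, LinearMap.ker_eq_bot']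
  intro m hm
  have hcell : ∀ j, ∀ᵐ y ∂((leb X).restrict (P.cell j)), (m : LTwo X) y = 0 := by
    intro j
    obtain ⟨v, hv⟩ := m.2 j
    have h1 : ∫ y in P.cell j, (m : LTwo X) y ∂(leb X) = 0 := congrFun hm j
    have h2 : ∫ y in P.cell j, (m : LTwo X) y ∂(leb X) = (leb X).real (P.cell j) • v := by
      rw [integral_congr_ae hv, setIntegral_const]
    have h3 : (leb X).real (P.cell j) ≠ 0 :=
      ENNReal.toReal_ne_zero.2 ⟨leb_cell_ne_zero P j, leb_cell_ne_top P j⟩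
    have h4 : v = 0 := by
      rw [h2] at h1
      exact (smul_eq_zero.1 h1).resolve_left h3
    filter_upwards [hv] with y hy
    rw [hy, h4]
  have hX : ∀ᵐ y ∂((leb X).restrict X), (m : LTwo X) y = 0 := by
    have := (ae_restrict_iUnion_iff (μ := leb X) P.cell fun y => (m : LTwo X) y = 0).2 hcell
    rwa [P.iUnion_cell] at this
  have hr : (leb X).restrict X = leb X := by
    have hXm : MeasurableSet X := by
      rw [← P.iUnion_cell]; exact MeasurableSet.iUnion P.measurableSet_cell
    simp [leb, Measure.restrict_smul, Measure.restrict_restrict hXm]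
  rw [hr] at hX
  apply Subtype.ext
  apply Lp.ext
  filter_upwards [hX, Lp.coeFn_zero (E d) 2 (leb X)] with y h1 h2
  rw [h1]
  simpa using h2.symm

instance instFiniteDimensionalStepMaps {d N : ℕ} {X : Set (E d)} (P : EquiPartition X N) :
    FiniteDimensional ℝ (stepMaps P) :=
  FiniteDimensional.of_injective (cellIntegral P) (cellIntegral_injective P)

instance instCompleteSpaceStepMaps {d N : ℕ} {X : Set (E d)} (P : EquiPartition X N) :
    CompleteSpace (stepMaps P) :=
  FiniteDimensional.complete ℝ (stepMaps P)

/-- `𝕄_N` carries its Borel sets; `volume` on it is then the Lebesgue measure of this finite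
dimensional Euclidean space. -/
instance instMeasurableSpaceStepMaps {d N : ℕ} {X : Set (E d)} (P : EquiPartition X N) :
    MeasurableSpace (stepMaps P) :=
  borel _

instance instBorelSpaceStepMaps {d N : ℕ} {X : Set (E d)} (P : EquiPartition X N) :
    BorelSpace (stepMaps P) :=
  ⟨rfl⟩

/-- The diagonal `𝔻_N ⊆ 𝕄_N`: the maps that take the same value on two distinct cells. -/
def diagonal {d N : ℕ} {X : Set (E d)} (P : EquiPartition X N) : Set (stepMaps P) :=
  {m | ∃ j k, j ≠ k ∧ ∃ v, HasValueOn P (m : LTwo X) j v ∧ HasValueOn P (m : LTwo X) k v}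

/-- The restriction of `d²_𝕊` to `𝕄_N`. -/
def distSqStep {d N : ℕ} {X : Set (E d)} (P : EquiPartition X N) (m : stepMaps P) : ℝ :=
  distSq X (m : LTwo X)

/-- `T` is an optimal transport map from `μ` to `ν` for the quadratic cost: it pushes `μ` forward
to `ν`, and its cost is minimal among the costs of all transport plans between `μ` and `ν`. -/
def IsOptimalTransportMap {d : ℕ} (μ ν : Measure (E d)) (T : E d → E d) : Prop :=
  Measurable T ∧ μ.map T = ν ∧
    ∀ γ : Measure (E d × E d), γ.fst = μ → γ.snd = ν →
      ∫⁻ y, ‖y - T y‖ₑ ^ 2 ∂μ ≤ ∫⁻ p, ‖p.1 - p.2‖ₑ ^ 2 ∂γ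

/-- The isobarycenter of `S ∩ X`. -/
def bary {d : ℕ} (X S : Set (E d)) : E d :=
  ((leb X).real S)⁻¹ • ∫ y in S, y ∂(leb X)

end VolPres

end

/-!
Since `‖m - s‖²` is the cost of the transport plan `(s, m)` between `leb X` and the law of `m`,
the squared distance to the measure preserving maps is bounded below by an optimal transport cost.
For a step map `m` with distinct values `x j` the target law is `siteMeasure x`, with mass `1 / N`
at each `x j`, and the transport problem is semi-discrete. Its Kantorovich dual is a convex function
of `N` weights `w` (`dualFunctional`). The partial derivatives of this function are
`1 / N - μ (laguerreCell x w j)`, so a minimizer is `Balanced`: all its Laguerre cells have mass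
`1 / N` (`exists_balanced`). The map `laguerreMap` from the `j`-th cell to `x j` is then optimal.
By complementary slackness (`integral_cost_eq`), every optimal map coincides with it almost
everywhere (`IsOptimalTransportMap.ae_eq_site`); in particular the balanced cells depend on `x` only
up to null sets.

An absolutely continuous measure can be transported by a map to every measure of the same mass
(`exists_map_eq`): a linear coordinate followed by its distribution function carries it to the
uniform law on `[0, 1]`, which can be carried to any law. Hence there is a measure preserving map `s`
that carries the `j`-th piece of the partition to the `j`-th Laguerre cell. It attains the lower
bound above, so it is a nearest point to `m` (`exists_nearest`).

For any other step map `m'`, the bound `distSq m' ≤ ‖m' - s‖²` is an equality at `m' = m`, and its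
right-hand side is a quadratic function of `m'` whose gradient at `m` is twice the projection of
`m - s` to the step maps; the values of this gradient are those of the theorem, because the cell
integrals of `s` are the integrals of the identity over the Laguerre cells. A function touched from
above in this way at every point of an open set is differentiable wherever the field of these
gradients is continuous (`hasGradientAt_of_le_add_sq`). Here it is continuous: normalized balanced
weights stay in a compact set, the integrals over the Laguerre cells are continuous in the sites and
the weights, and the balanced cells are unique (`continuousAt_setIntegral_balanced`).

Differentiability almost everywhere on the whole space is Rademacher's theorem, since the distance to
a set is Lipschitz.
-/

namespace VolPres

open Set Filter Topology ProbabilityTheory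

/-! ### Transporting an absolutely continuous measure by a map -/

section Representation

open scoped unitInterval

lemma continuous_cdf (μ : Measure ℝ) [IsProbabilityMeasure μ] (hμ : ∀ a, μ {a} = 0) :
    Continuous (cdf μ) := by
  refine continuous_iff_continuousAt.2 fun a => ?_
  rw [(monotone_cdf μ).continuousAt_iff_leftLim_eq_rightLim, (cdf μ).rightLim_eq]
  have h := (cdf μ).measure_singleton a
  rw [measure_cdf, hμ, eq_comm, ENNReal.ofReal_eq_zero] at h
  exact le_antisymm ((monotone_cdf μ).leftLim_le le_rfl) (by linarith)

lemma measure_cdf_le (μ : Measure ℝ) [IsProbabilityMeasure μ] (hμ : ∀ a, μ {a} = 0) {t : ℝ}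
    (ht : t ∈ Icc (0 : ℝ) 1) : μ {a | cdf μ a ≤ t} = ENNReal.ofReal t := by
  have hc := continuous_cdf μ hμ
  have hlevel : ∀ r ∈ Ioo (0 : ℝ) 1, ∃ a, cdf μ a = r := by
    intro r hr
    obtain ⟨a, ha⟩ := ((tendsto_cdf_atBot μ).eventually_lt_const hr.1).exists
    obtain ⟨b, hb⟩ := ((tendsto_cdf_atTop μ).eventually_const_lt hr.2).exists
    exact mem_range_of_exists_le_of_exists_ge hc ⟨a, ha.le⟩ ⟨b, hb.le⟩
  rcases eq_or_lt_of_le ht.2 with rfl | h1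
  · simp [cdf_le_one]
  apply le_antisymm
  · refine le_of_forall_gt_imp_ge_of_dense fun r hr => ?_
    by_cases hr1 : r < 1
    · have hrt : r ≠ ∞ := (hr1.trans ENNReal.one_lt_top).ne
      have htr : t < r.toReal := (ENNReal.ofReal_lt_iff_lt_toReal ht.1 hrt).1 hr
      obtain ⟨a, ha⟩ := hlevel r.toReal ⟨ht.1.trans_lt htr, by
        simpa using (ENNReal.toReal_lt_toReal hrt ENNReal.one_ne_top).2 hr1⟩
      calc μ {a | cdf μ a ≤ t} ≤ μ (Iic a) := measure_mono fun b hb => by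
            by_contra hab
            have := monotone_cdf μ (not_le.1 hab).le
            rw [ha] at this
            exact absurd (hb : cdf μ b ≤ t) (htr.trans_le this).not_ge
        _ = r := by rw [← ofReal_cdf, ha, ENNReal.ofReal_toReal hrt]
    · exact prob_le_one.trans (not_lt.1 hr1)
  · rcases eq_or_lt_of_le ht.1 with rfl | h0
    · simp
    obtain ⟨a, ha⟩ := hlevel t ⟨h0, h1⟩
    rw [← ha, ofReal_cdf]
    exact measure_mono fun b hb => monotone_cdf μ hb

/-- The probability integral transform: an atomless law on the line is carried to the uniform
law on `[0, 1]` by its distribution function. -/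
lemma exists_map_eq_volume_unitInterval (μ : Measure ℝ) [IsProbabilityMeasure μ]
    (hμ : ∀ a, μ {a} = 0) :
    ∃ f : ℝ → I, Measurable f ∧ μ.map f = (volume : Measure I) := by
  have hm : Measurable fun a => (⟨cdf μ a, cdf_nonneg μ a, cdf_le_one μ a⟩ : I) :=
    (continuous_cdf μ hμ).measurable.subtype_mk
  have := Measure.isProbabilityMeasure_map (μ := μ) hm.aemeasurable
  refine ⟨_, hm, Measure.ext_of_Iic _ _ fun t => ?_⟩
  rw [Measure.map_apply hm measurableSet_Iic, unitInterval.volume_Iic, ← measure_cdf_le μ hμ t.2]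
  rfl

lemma volume_hyperplane {d : ℕ} {a : E d} (ha : a ≠ 0) (c : ℝ) :
    volume {y : E d | inner ℝ a y = c} = 0 := by
  by_cases hne : ∃ z : E d, inner ℝ a z = c
  · obtain ⟨z, hz⟩ := hne
    have hs : {y : E d | inner ℝ a y = c} =
        (fun y => -z + y) ⁻¹' ((innerSL ℝ a).ker : Set (E d)) := by
      ext y
      simp [inner_add_right, hz, neg_add_eq_zero, eq_comm (a := c)]
    rw [hs, measure_preimage_add]
    refine Measure.addHaar_submodule _ _ fun h => ha ?_
    have : a ∈ (innerSL ℝ a).ker := h ▸ Submodule.mem_top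
    simpa using this
  · push Not at hne
    simp [hne]

lemma exists_map_eq_of_prob {d : ℕ} (μ ν : Measure (E d)) [IsProbabilityMeasure μ]
    [IsProbabilityMeasure ν] (hμ : μ ≪ volume) :
    ∃ f : E d → E d, Measurable f ∧ μ.map f = ν := by
  -- In dimension `0` there is no coordinate, but there is only one probability measure.
  rcases Nat.eq_zero_or_pos d with rfl | hd
  · refine ⟨id, measurable_id, ?_⟩
    rw [Measure.map_id]
    ext s -
    rcases Subsingleton.eq_empty_or_singleton (subsingleton_of_subsingleton (s := s)) with
      rfl | ⟨x, rfl⟩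
    · simp
    · have : ({x} : Set (E 0)) = univ := by
        ext y; simp [Subsingleton.elim y x]
      rw [this, measure_univ, measure_univ]
  · set a : E d := EuclideanSpace.single ⟨0, hd⟩ 1 with ha
    have ha0 : a ≠ 0 := by simp [ha]
    have hm : Measurable fun y : E d => (inner ℝ a y : ℝ) := by fun_prop
    have := Measure.isProbabilityMeasure_map (μ := μ) hm.aemeasurable
    obtain ⟨f, hf, hfμ⟩ := exists_map_eq_volume_unitInterval (μ.map fun y => (inner ℝ a y : ℝ))
      fun c => by
        rw [Measure.map_apply hm (measurableSet_singleton c)]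
        exact hμ (volume_hyperplane ha0 c)
    obtain ⟨g, hg, hgν⟩ := ν.exists_measurable_map_eq
    refine ⟨g ∘ f ∘ fun y => inner ℝ a y, hg.comp (hf.comp hm), ?_⟩
    rw [← Measure.map_map hg (hf.comp hm), ← Measure.map_map hf hm, hfμ, hgν]

/-- An absolutely continuous finite measure on `ℝ^d` can be transported by a map to every measure
of the same mass. -/
lemma exists_map_eq {d : ℕ} (μ ν : Measure (E d)) [IsFiniteMeasure μ] (hμ : μ ≪ volume)
    (h : μ univ = ν univ) : ∃ f : E d → E d, Measurable f ∧ μ.map f = ν := by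
  rcases eq_or_ne μ 0 with rfl | h0
  · refine ⟨id, measurable_id, ?_⟩
    have : ν = 0 := Measure.measure_univ_eq_zero.1 (by simpa using h.symm)
    simp [this]
  have hc0 : μ univ ≠ 0 := by simpa using h0
  have hct : μ univ ≠ ∞ := measure_ne_top _ _
  have : IsProbabilityMeasure ((μ univ)⁻¹ • μ) := ⟨by simp [ENNReal.inv_mul_cancel hc0 hct]⟩
  have : IsProbabilityMeasure ((μ univ)⁻¹ • ν) := ⟨by
    simp [← h, ENNReal.inv_mul_cancel hc0 hct]⟩
  obtain ⟨f, hf, hfν⟩ := exists_map_eq_of_prob ((μ univ)⁻¹ • μ) ((μ univ)⁻¹ • ν)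
    (Measure.smul_absolutelyContinuous.trans hμ)
  refine ⟨f, hf, ?_⟩
  rw [Measure.map_smul] at hfν
  have := congrArg (fun ρ => μ univ • ρ) hfν
  simpa [smul_smul, ENNReal.mul_inv_cancel hc0 hct] using this

end Representation

/-! ### Decompositions of a measure into pieces -/

lemma sum_restrict_eq {α ι : Type*} [MeasurableSpace α] [Fintype ι] {μ : Measure α}
    {A : ι → Set α} (hA : ∀ j, MeasurableSet (A j))
    (hd : Pairwise fun j k => AEDisjoint μ (A j) (A k)) (hcov : ∀ᵐ y ∂μ, ∃ j, y ∈ A j) :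
    ∑ j, μ.restrict (A j) = μ := by
  rw [← Measure.sum_fintype, ← Measure.restrict_iUnion_ae hd fun j => (hA j).nullMeasurableSet]
  refine Measure.restrict_eq_self_of_ae_mem ?_
  simpa using hcov

lemma sum_indicator_ae_eq {α ι F : Type*} [MeasurableSpace α] [Fintype ι] [AddCommMonoid F]
    {μ : Measure α} {A : ι → Set α} (hA : ∀ j, MeasurableSet (A j))
    (hd : Pairwise fun j k => AEDisjoint μ (A j) (A k)) (f : ι → α → F) (j : ι) :
    (fun y => ∑ k, (A k).indicator (f k) y) =ᵐ[μ.restrict (A j)] f j := by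
  have hnot : ∀ᵐ y ∂(μ.restrict (A j)), ∀ k, k ≠ j → y ∉ A k := by
    refine ae_all_iff.2 fun k => ?_
    by_cases hk : k = j
    · simp [hk]
    · have h0 : μ.restrict (A j) (A k) = 0 := by
        rw [Measure.restrict_apply (hA k)]
        exact hd hk
      filter_upwards [compl_mem_ae_iff.2 h0] with y hy _ using hy
  filter_upwards [hnot, ae_restrict_mem (hA j)] with y hy hyj
  rw [Finset.sum_eq_single_of_mem j (Finset.mem_univ _) fun k _ hk =>
    indicator_of_notMem (hy k hk) _, indicator_of_mem hyj]

lemma map_eq_sum_of_piecewise {α β ι : Type*} [MeasurableSpace α] [MeasurableSpace β] [Fintype ι]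
    {μ : Measure α} {A : ι → Set α} (hdec : ∑ j, μ.restrict (A j) = μ) {f : α → β}
    (hf : AEMeasurable f μ) {g : ι → α → β} (hg : ∀ j, f =ᵐ[μ.restrict (A j)] g j) :
    μ.map f = ∑ j, (μ.restrict (A j)).map (g j) := by
  have h : ∑ j, (μ.restrict (A j)).map f = μ.map f := by
    conv_rhs => rw [← hdec]
    rw [← Measure.sum_fintype, ← Measure.sum_fintype, Measure.map_sum]
    rwa [Measure.sum_fintype, hdec]
  rw [← h]
  exact Finset.sum_congr rfl fun j _ => Measure.map_congr (hg j)

lemma lintegral_enorm_sq {α F : Type*} [MeasurableSpace α] [NormedAddCommGroup F]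
    {μ : Measure α} {f : α → F} (hf : Integrable (fun y => ‖f y‖ ^ 2) μ) :
    ∫⁻ y, ‖f y‖ₑ ^ 2 ∂μ = ENNReal.ofReal (∫ y, ‖f y‖ ^ 2 ∂μ) := by
  rw [ofReal_integral_eq_lintegral_ofReal hf (Eventually.of_forall fun y => by positivity)]
  refine lintegral_congr fun y => ?_
  rw [ENNReal.ofReal_pow (norm_nonneg _), ofReal_norm]

/-! ### Laguerre cells -/

section Laguerre

variable {d N : ℕ}

/-- The open Laguerre cell of the site `x j` for the weights `w`: the points `y` at which the
affine function `⟪x j, y⟫ - w j` is strictly larger than all the others. -/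
def laguerreCell (x : Fin N → E d) (w : Fin N → ℝ) (j : Fin N) : Set (E d) :=
  {y | ∀ k, k ≠ j → inner ℝ (x k) y - w k < inner ℝ (x j) y - w j}

/-- The maximum of the affine functions `⟪x j, y⟫ - w j`. -/
noncomputable def potential (x : Fin N → E d) (w : Fin N → ℝ) (y : E d) : ℝ :=
  ⨆ j, (inner ℝ (x j) y - w j)

lemma isOpen_laguerreCell (x : Fin N → E d) (w : Fin N → ℝ) (j : Fin N) :
    IsOpen (laguerreCell x w j) := by
  simp only [laguerreCell, ofPred_forall]
  refine isOpen_iInter_of_finite fun k => isOpen_iInter_of_finite fun _ =>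
    isOpen_lt (by fun_prop) (by fun_prop)

lemma measurableSet_laguerreCell (x : Fin N → E d) (w : Fin N → ℝ) (j : Fin N) :
    MeasurableSet (laguerreCell x w j) :=
  (isOpen_laguerreCell x w j).measurableSet

lemma eventually_mem_laguerreCell {x : Fin N → E d} {w : Fin N → ℝ} {j : Fin N} {y : E d}
    (hy : y ∈ laguerreCell x w j) :
    ∀ᶠ p : (Fin N → E d) × (Fin N → ℝ) in 𝓝 (x, w), y ∈ laguerreCell p.1 p.2 j := by
  have ho : IsOpen {p : (Fin N → E d) × (Fin N → ℝ) | y ∈ laguerreCell p.1 p.2 j} := by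
    have he : {p : (Fin N → E d) × (Fin N → ℝ) | y ∈ laguerreCell p.1 p.2 j} =
        ⋂ k, ⋂ (_ : k ≠ j), {p | inner ℝ (p.1 k) y - p.2 k < inner ℝ (p.1 j) y - p.2 j} := by
      ext p; simp [laguerreCell]
    rw [he]
    refine isOpen_iInter_of_finite fun k => isOpen_iInter_of_finite fun _ =>
      isOpen_lt (by fun_prop) (by fun_prop)
  exact ho.mem_nhds hy

lemma eq_of_mem_laguerreCell {x : Fin N → E d} {w : Fin N → ℝ} {j k : Fin N} {y : E d}
    (hj : y ∈ laguerreCell x w j) (hk : y ∈ laguerreCell x w k) : j = k := by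
  by_contra h
  exact lt_asymm (hj k (Ne.symm h)) (hk j h)

lemma le_potential (x : Fin N → E d) (w : Fin N → ℝ) (y : E d) (j : Fin N) :
    inner ℝ (x j) y - w j ≤ potential x w y :=
  le_ciSup (f := fun j => inner ℝ (x j) y - w j) (finite_range _).bddAbove j

lemma potential_eq_of_mem {x : Fin N → E d} {w : Fin N → ℝ} {j : Fin N} {y : E d}
    (hy : y ∈ laguerreCell x w j) : potential x w y = inner ℝ (x j) y - w j := by
  have : Nonempty (Fin N) := ⟨j⟩
  refine le_antisymm (ciSup_le fun k => ?_) (le_potential x w y j)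
  rcases eq_or_ne k j with rfl | h
  · exact le_rfl
  · exact (hy k h).le

/-- In its Laguerre cell, a site is the only maximizer. -/
lemma eq_of_mem_of_potential_eq {x : Fin N → E d} {w : Fin N → ℝ} {j k : Fin N} {y : E d}
    (hy : y ∈ laguerreCell x w j) (hk : potential x w y = inner ℝ (x k) y - w k) : k = j := by
  by_contra h
  have := hy k h
  rw [potential_eq_of_mem hy] at hk
  linarith

lemma exists_potential_eq [NeZero N] (x : Fin N → E d) (w : Fin N → ℝ) (y : E d) :
    ∃ j, potential x w y = inner ℝ (x j) y - w j := by
  obtain ⟨j, hj⟩ := exists_eq_ciSup_of_finite (f := fun j => inner ℝ (x j) y - w j)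
  exact ⟨j, hj.symm⟩

lemma continuous_potential [NeZero N] (x : Fin N → E d) (w : Fin N → ℝ) :
    Continuous (potential x w) := by
  have h : potential x w = fun y => Finset.univ.sup' Finset.univ_nonempty
      fun j => inner ℝ (x j) y - w j := by
    ext y; rw [Finset.sup'_univ_eq_ciSup]; rfl
  rw [h]
  exact Continuous.finset_sup'_apply _ fun j _ => by fun_prop

variable {μ : Measure (E d)}

/-- Off the hyperplanes where two of the affine functions agree, a point lies in one of the
cells. -/
lemma ae_mem_laguerreCell [NeZero N] (hac : μ ≪ volume) {x : Fin N → E d}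
    (hx : Function.Injective x) (w : Fin N → ℝ) : ∀ᵐ y ∂μ, ∃ j, y ∈ laguerreCell x w j := by
  have h : ∀ᵐ y ∂μ, ∀ j k, j ≠ k → inner ℝ (x k - x j) y ≠ w k - w j := by
    refine ae_all_iff.2 fun j => ae_all_iff.2 fun k => ?_
    by_cases hjk : j = k
    · simp [hjk]
    · have := hac (volume_hyperplane (sub_ne_zero.2 fun h => hjk (hx h).symm) (w k - w j))
      filter_upwards [compl_mem_ae_iff.2 this] with y hy _ using hy
  filter_upwards [h] with y hy
  obtain ⟨j, hj⟩ := exists_potential_eq x w y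
  refine ⟨j, fun k hk => lt_of_le_of_ne (hj ▸ le_potential x w y k) fun he => ?_⟩
  refine hy j k hk.symm ?_
  rw [inner_sub_left]
  linarith

lemma pairwise_aedisjoint_laguerreCell (x : Fin N → E d) (w : Fin N → ℝ) :
    Pairwise fun j k => AEDisjoint μ (laguerreCell x w j) (laguerreCell x w k) := fun _ _ hjk =>
  (disjoint_left.2 fun _ hj hk => hjk (eq_of_mem_laguerreCell hj hk)).aedisjoint

lemma sum_restrict_laguerreCell [NeZero N] (hac : μ ≪ volume) {x : Fin N → E d}
    (hx : Function.Injective x) (w : Fin N → ℝ) : ∑ j, μ.restrict (laguerreCell x w j) = μ :=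
  sum_restrict_eq (measurableSet_laguerreCell x w) (pairwise_aedisjoint_laguerreCell x w)
    (ae_mem_laguerreCell hac hx w)

/-- The integral of a function over a Laguerre cell depends continuously on the sites and the
weights, as long as the sites are distinct. -/
lemma continuousAt_setIntegral_laguerreCell [NeZero N] (hac : μ ≪ volume) {x : Fin N → E d}
    (hx : Function.Injective x) (w : Fin N → ℝ) {F : Type*} [NormedAddCommGroup F]
    [NormedSpace ℝ F] {g : E d → F} (hg : Integrable g μ) (j : Fin N) :
    ContinuousAt (fun p : (Fin N → E d) × (Fin N → ℝ) => ∫ y in laguerreCell p.1 p.2 j, g y ∂μ)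
      (x, w) := by
  simp only [← integral_indicator (measurableSet_laguerreCell _ _ _)]
  refine continuousAt_of_dominated (bound := fun y => ‖g y‖)
    (Eventually.of_forall fun p =>
      hg.aestronglyMeasurable.indicator (measurableSet_laguerreCell _ _ _))
    (Eventually.of_forall fun p => Eventually.of_forall fun y => norm_indicator_le_norm_self _ _)
    hg.norm ?_
  filter_upwards [ae_mem_laguerreCell hac hx w] with y ⟨k, hk⟩
  refine continuousAt_const (y := (laguerreCell x w j).indicator g y) |>.congr ?_
  filter_upwards [eventually_mem_laguerreCell hk] with p hp
  by_cases hjk : k = j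
  · subst hjk
    simp [hk, hp]
  · rw [indicator_of_notMem fun h => hjk (eq_of_mem_laguerreCell hk h),
      indicator_of_notMem fun h => hjk (eq_of_mem_laguerreCell hp h)]

/-! ### Balanced weights -/

/-- The weights `w` are balanced for the sites `x` if all the Laguerre cells have equal mass. -/
def Balanced (μ : Measure (E d)) (x : Fin N → E d) (w : Fin N → ℝ) : Prop :=
  ∀ j, μ.real (laguerreCell x w j) = (N : ℝ)⁻¹

lemma Balanced.measure_eq [NeZero N] [IsFiniteMeasure μ] {x : Fin N → E d} {w : Fin N → ℝ}
    (h : Balanced μ x w) (j : Fin N) : μ (laguerreCell x w j) = (N : ℝ≥0∞)⁻¹ := by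
  rw [← ofReal_measureReal, h j, ENNReal.ofReal_inv_of_pos (by exact_mod_cast NeZero.pos N),
    ENNReal.ofReal_natCast]

lemma laguerreCell_sub_const (x : Fin N → E d) (w : Fin N → ℝ) (c : ℝ) (j : Fin N) :
    laguerreCell x (fun k => w k - c) j = laguerreCell x w j := by
  ext y
  refine forall_congr' fun k => imp_congr_right fun _ => ?_
  constructor <;> intro h <;> linarith

lemma potential_sub_const [NeZero N] (x : Fin N → E d) (w : Fin N → ℝ) (c : ℝ) (y : E d) :
    potential x (fun k => w k - c) y = potential x w y + c := by
  apply le_antisymm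
  · obtain ⟨j, hj⟩ := exists_potential_eq x (fun k => w k - c) y
    rw [hj]
    linarith [le_potential x w y j]
  · obtain ⟨j, hj⟩ := exists_potential_eq x w y
    rw [hj]
    linarith [le_potential x (fun k => w k - c) y j]

lemma inner_le_of_norm_le {x : Fin N → E d} {y : E d} {R : ℝ} (hy : ‖y‖ ≤ R) (j : Fin N) :
    |inner ℝ (x j) y| ≤ ‖x‖ * R :=
  (abs_real_inner_le_norm _ _).trans
    (mul_le_mul (norm_le_pi_norm x j) hy (norm_nonneg _) (norm_nonneg _))

lemma abs_potential_le [NeZero N] (x : Fin N → E d) (w : Fin N → ℝ) {y : E d} {R : ℝ}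
    (hy : ‖y‖ ≤ R) : |potential x w y| ≤ ‖x‖ * R + ‖w‖ := by
  obtain ⟨j, hj⟩ := exists_potential_eq x w y
  rw [hj]
  exact (abs_sub _ _).trans (add_le_add (inner_le_of_norm_le hy j) (norm_le_pi_norm w j))

lemma integrable_potential [NeZero N] [IsFiniteMeasure μ] {R : ℝ} (hR : ∀ᵐ y ∂μ, ‖y‖ ≤ R)
    (x : Fin N → E d) (w : Fin N → ℝ) : Integrable (potential x w) μ :=
  Integrable.of_bound (continuous_potential x w).aestronglyMeasurable (‖x‖ * R + ‖w‖)
    (hR.mono fun _ hy => abs_potential_le x w hy)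

/-- The dual functional of the semi-discrete transport problem onto `N` sites of equal mass. -/
noncomputable def dualFunctional (μ : Measure (E d)) (x : Fin N → E d) (w : Fin N → ℝ) : ℝ :=
  ∫ y, potential x w y ∂μ + (∑ j, w j) * (N : ℝ)⁻¹

lemma continuous_dualFunctional [NeZero N] [IsProbabilityMeasure μ] {R : ℝ}
    (hR : ∀ᵐ y ∂μ, ‖y‖ ≤ R) (x : Fin N → E d) : Continuous (dualFunctional μ x) := by
  refine Continuous.add (LipschitzWith.of_le_add_mul 1 fun w w' => ?_).continuous (by fun_prop)
  calc ∫ y, potential x w y ∂μ ≤ ∫ y, (potential x w' y + dist w w') ∂μ := by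
        refine integral_mono (integrable_potential hR x w)
          ((integrable_potential hR x w').add (integrable_const _)) fun y => ?_
        obtain ⟨j, hj⟩ := exists_potential_eq x w y
        have h1 := (le_abs_self _).trans ((abs_sub_comm _ _).trans_le
          ((Real.dist_eq _ _).symm.trans_le (dist_le_pi_dist w w' j)))
        have h2 := le_potential x w' y j
        simp only [hj]
        linarith
    _ = ∫ y, potential x w' y ∂μ + (1 : NNReal) * dist w w' := by
        rw [integral_add (integrable_potential hR x w') (integrable_const _)]
        simp

lemma dualFunctional_sub_const [NeZero N] [IsProbabilityMeasure μ] {R : ℝ}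
    (hR : ∀ᵐ y ∂μ, ‖y‖ ≤ R) (x : Fin N → E d) (w : Fin N → ℝ) (c : ℝ) :
    dualFunctional μ x (fun k => w k - c) = dualFunctional μ x w := by
  have hN : (N : ℝ) ≠ 0 := by exact_mod_cast NeZero.ne N
  simp only [dualFunctional, potential_sub_const]
  rw [integral_add (integrable_potential hR x w) (integrable_const _)]
  simp [Finset.sum_sub_distrib]
  field_simp
  ring

/-- The defects `1 / N - μ (cell j)` form a subgradient of the dual functional. -/
lemma dualFunctional_add_le [NeZero N] [IsProbabilityMeasure μ] (hac : μ ≪ volume) {R : ℝ}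
    (hR : ∀ᵐ y ∂μ, ‖y‖ ≤ R) {x : Fin N → E d} (hx : Function.Injective x) (w w' : Fin N → ℝ) :
    dualFunctional μ x w + ∑ j, (w' j - w j) * ((N : ℝ)⁻¹ - μ.real (laguerreCell x w j)) ≤
      dualFunctional μ x w' := by
  have hi : ∀ j, Integrable ((laguerreCell x w j).indicator fun _ => w' j - w j) μ := fun j =>
    (integrable_const _).indicator (measurableSet_laguerreCell x w j)
  have h : ∫ y, potential x w y ∂μ - ∑ j, (w' j - w j) * μ.real (laguerreCell x w j) ≤
      ∫ y, potential x w' y ∂μ := by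
    have he : ∑ j, (w' j - w j) * μ.real (laguerreCell x w j) =
        ∫ y, ∑ j, (laguerreCell x w j).indicator (fun _ => w' j - w j) y ∂μ := by
      rw [integral_finsetSum _ fun j _ => hi j]
      refine Finset.sum_congr rfl fun j _ => ?_
      rw [integral_indicator (measurableSet_laguerreCell x w j), setIntegral_const, smul_eq_mul,
        mul_comm]
    rw [he, ← integral_sub (integrable_potential hR x w) (integrable_finsetSum _ fun j _ => hi j)]
    refine integral_mono_ae ((integrable_potential hR x w).sub
      (integrable_finsetSum _ fun j _ => hi j)) (integrable_potential hR x w') ?_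
    filter_upwards [ae_mem_laguerreCell hac hx w] with y ⟨j, hj⟩
    rw [Finset.sum_eq_single_of_mem j (Finset.mem_univ _) fun k _ hk =>
      indicator_of_notMem (fun h => hk (eq_of_mem_laguerreCell h hj)) _, indicator_of_mem hj,
      potential_eq_of_mem hj]
    linarith [le_potential x w' y j]
  have h2 : ∑ j, (w' j - w j) * ((N : ℝ)⁻¹ - μ.real (laguerreCell x w j)) =
      (∑ j, w' j) * (N : ℝ)⁻¹ - (∑ j, w j) * (N : ℝ)⁻¹ -
        ∑ j, (w' j - w j) * μ.real (laguerreCell x w j) := by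
    simp only [mul_sub, Finset.sum_sub_distrib, sub_mul, Finset.sum_mul]
  simp only [dualFunctional, h2]
  linarith

lemma nonneg_of_ae_norm_le [NeZero μ] {R : ℝ} (hR : ∀ᵐ y ∂μ, ‖y‖ ≤ R) : 0 ≤ R := by
  obtain ⟨y, hy⟩ := hR.exists
  exact (norm_nonneg y).trans hy

/-- The dual functional is invariant under addition of constants to the weights, and it is large
when the least weight is `0` and the largest one is far from it; hence it attains its minimum. -/
lemma exists_forall_dualFunctional_le [NeZero N] [IsProbabilityMeasure μ] {R : ℝ}
    (hR : ∀ᵐ y ∂μ, ‖y‖ ≤ R) (x : Fin N → E d) :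
    ∃ w, ∀ w', dualFunctional μ x w ≤ dualFunctional μ x w' := by
  have hN : (0 : ℝ) < N := by exact_mod_cast NeZero.pos N
  have hR0 := nonneg_of_ae_norm_le hR
  set C := ‖x‖ * R with hC
  have hC0 : 0 ≤ C := by positivity
  set B : Fin N → ℝ := fun _ => 2 * C * N with hB
  have h0B : (0 : Fin N → ℝ) ∈ Icc 0 B := ⟨le_rfl, fun _ => by simp only [hB]; positivity⟩
  obtain ⟨w, hw, hmin⟩ := (isCompact_Icc (a := (0 : Fin N → ℝ)) (b := B)).exists_isMinOn ⟨0, h0B⟩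
    (continuous_dualFunctional hR x).continuousOn
  refine ⟨w, fun w' => ?_⟩
  -- Shift the weights so that the least one is `0`.
  obtain ⟨i, hi⟩ := Finite.exists_min w'
  rw [← dualFunctional_sub_const hR x w' (w' i)]
  set v : Fin N → ℝ := fun k => w' k - w' i with hv
  have hv0 : ∀ k, 0 ≤ v k := fun k => sub_nonneg.2 (hi k)
  by_cases hvB : ∀ k, v k ≤ 2 * C * N
  · exact hmin ⟨hv0, hvB⟩
  -- Outside the box the value at `v` exceeds `-C + 2 * C`, and the value at `0` is at most `C`.
  push Not at hvB
  obtain ⟨k, hk⟩ := hvB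
  refine (hmin h0B).trans ?_
  have h1 : dualFunctional μ x 0 ≤ C := by
    have : ∫ y, potential x 0 y ∂μ ≤ ∫ _, C ∂μ := by
      refine integral_mono_ae (integrable_potential hR x 0) (integrable_const _) ?_
      filter_upwards [hR] with y hy
      simpa using (le_abs_self _).trans (abs_potential_le x 0 hy)
    simpa [dualFunctional] using this
  have h2 : -C ≤ ∫ y, potential x v y ∂μ := by
    have : ∫ _, -C ∂μ ≤ ∫ y, potential x v y ∂μ := by
      refine integral_mono_ae (integrable_const _) (integrable_potential hR x v) ?_
      filter_upwards [hR] with y hy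
      have h := le_potential x v y i
      have hvi : v i = 0 := sub_self _
      linarith [neg_le_of_abs_le (inner_le_of_norm_le (x := x) hy i)]
    simpa using this
  have h3 : 2 * C ≤ (∑ j, v j) * (N : ℝ)⁻¹ := by
    rw [← div_eq_mul_inv, le_div_iff₀ hN]
    exact hk.le.trans (Finset.single_le_sum (fun j _ => hv0 j) (Finset.mem_univ k))
  simp only [dualFunctional] at h1 ⊢
  linarith

/-- A minimizer of the dual functional is balanced, since this functional is differentiable with
partial derivatives `1 / N - μ (cell j)`. -/
lemma exists_balanced [NeZero N] [IsProbabilityMeasure μ] (hac : μ ≪ volume) {R : ℝ}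
    (hR : ∀ᵐ y ∂μ, ‖y‖ ≤ R) {x : Fin N → E d} (hx : Function.Injective x) :
    ∃ w, Balanced μ x w := by
  obtain ⟨w, hw⟩ := exists_forall_dualFunctional_le hR x
  refine ⟨w, fun j => ?_⟩
  -- Compare the minimum with the value at `w + t • e j`, by the subgradient at the latter point,
  -- and let `t` tend to `0` from either side.
  set c : ℝ → Fin N → ℝ := fun t => w + t • Pi.single j 1 with hc
  have hc0 : c 0 = w := by simp [hc]
  have hcc : Continuous c := by fun_prop
  set h : ℝ → ℝ := fun t => (N : ℝ)⁻¹ - μ.real (laguerreCell x (c t) j) with hh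
  have hsign : ∀ t, 0 ≤ t * h t := by
    intro t
    have h1 := dualFunctional_add_le hac hR hx (c t) w
    have h2 := hw (c t)
    rw [Finset.sum_eq_single_of_mem j (Finset.mem_univ _) fun k _ hk => by simp [hc, hk]] at h1
    have h3 : w j - c t j = -t := by simp [hc]
    rw [h3] at h1
    simp only [hh]
    linarith
  have hcont : Tendsto h (𝓝 0) (𝓝 (h 0)) := by
    have h1 := continuousAt_setIntegral_laguerreCell hac hx w (g := fun _ => (1 : ℝ))
      (integrable_const _) j
    have h2 : ContinuousAt (fun t => (x, c t)) 0 := by fun_prop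
    have h3 := ContinuousAt.comp_of_eq (f := fun t => (x, c t)) h1 h2 (by simp [hc0])
    simp only [Function.comp_def, setIntegral_const, smul_eq_mul, mul_one] at h3
    exact (continuousAt_const.sub h3).tendsto
  have hpos : 0 ≤ h 0 := by
    refine ge_of_tendsto (hcont.mono_left (nhdsWithin_le_nhds (s := Ioi 0))) ?_
    filter_upwards [self_mem_nhdsWithin] with t ht
    exact nonneg_of_mul_nonneg_right (hsign t) ht
  have hneg : h 0 ≤ 0 := by
    refine le_of_tendsto (hcont.mono_left (nhdsWithin_le_nhds (s := Iio 0))) ?_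
    filter_upwards [self_mem_nhdsWithin] with t ht
    exact nonpos_of_mul_nonneg_right (hsign t) ht
  have h0 : h 0 = 0 := le_antisymm hneg hpos
  simp only [hh, hc0] at h0
  linarith

lemma Balanced.weight_sub_le [NeZero N] [IsFiniteMeasure μ] {R : ℝ} (hR : ∀ᵐ y ∂μ, ‖y‖ ≤ R)
    {x : Fin N → E d} {w : Fin N → ℝ} (hw : Balanced μ x w) (i k : Fin N) :
    w i - w k ≤ 2 * (‖x‖ * R) := by
  have hpos : μ.restrict (laguerreCell x w i) ≠ 0 := by
    rw [Ne, Measure.restrict_eq_zero, hw.measure_eq]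
    simp
  have : NeZero (μ.restrict (laguerreCell x w i)) := ⟨hpos⟩
  obtain ⟨y, hy, hyR⟩ := ((ae_restrict_mem (measurableSet_laguerreCell x w i)).and
    (ae_restrict_of_ae hR)).exists
  have h1 := le_potential x w y k
  rw [potential_eq_of_mem hy] at h1
  have h2 := le_of_abs_le (inner_le_of_norm_le (x := x) hyR i)
  have h3 := neg_le_of_abs_le (inner_le_of_norm_le (x := x) hyR k)
  linarith

/-- Balanced weights, normalized so that the first one vanishes, are bounded by the sites. -/
lemma exists_balanced_norm_le [NeZero N] [IsProbabilityMeasure μ] (hac : μ ≪ volume) {R : ℝ}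
    (hR : ∀ᵐ y ∂μ, ‖y‖ ≤ R) {x : Fin N → E d} (hx : Function.Injective x) :
    ∃ w, Balanced μ x w ∧ ‖w‖ ≤ 2 * (‖x‖ * R) := by
  obtain ⟨w, hw⟩ := exists_balanced hac hR hx
  have hR0 := nonneg_of_ae_norm_le hR
  refine ⟨fun k => w k - w 0, fun j => by rw [laguerreCell_sub_const, hw j], ?_⟩
  refine (pi_norm_le_iff_of_nonneg (by positivity)).2 fun k => ?_
  rw [Real.norm_eq_abs, abs_le]
  exact ⟨by linarith [hw.weight_sub_le hR 0 k], hw.weight_sub_le hR k 0⟩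

end Laguerre

/-! ### Optimal transport onto finitely many sites -/

section Transport

variable {d N : ℕ} {μ : Measure (E d)}

/-- The probability measure that gives the mass `1 / N` to each site. -/
noncomputable def siteMeasure (x : Fin N → E d) : Measure (E d) :=
  ∑ j, (N : ℝ≥0∞)⁻¹ • Measure.dirac (x j)

lemma siteMeasure_compl_range (x : Fin N → E d) : siteMeasure x (range x)ᶜ = 0 := by
  simp [siteMeasure]

instance isFiniteMeasure_siteMeasure [NeZero N] (x : Fin N → E d) :
    IsFiniteMeasure (siteMeasure x) := ⟨by
  simp only [siteMeasure, Measure.finsetSum_apply, Measure.smul_apply, measure_univ]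
  simp [ENNReal.mul_lt_top_iff, NeZero.pos N]⟩

lemma ae_siteMeasure_mem (x : Fin N → E d) : ∀ᵐ z ∂(siteMeasure x), ∃ j, z = x j := by
  have h : siteMeasure x (range x)ᶜ = 0 := siteMeasure_compl_range x
  filter_upwards [compl_mem_ae_iff.2 h] with z hz
  obtain ⟨j, hj⟩ := not_not.1 hz
  exact ⟨j, hj.symm⟩

/-- A map that is equal to `x j` on the `j`-th piece of a decomposition into pieces of equal mass
pushes the measure forward to `siteMeasure x`. -/
lemma map_eq_siteMeasure {α : Type*} [MeasurableSpace α] {μ : Measure α} {A : Fin N → Set α}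
    (hdec : ∑ j, μ.restrict (A j) = μ) (hA : ∀ j, μ (A j) = (N : ℝ≥0∞)⁻¹) {x : Fin N → E d}
    {f : α → E d} (hf : AEMeasurable f μ) (hfx : ∀ j, ∀ᵐ y ∂(μ.restrict (A j)), f y = x j) :
    μ.map f = siteMeasure x := by
  rw [map_eq_sum_of_piecewise hdec hf (g := fun j _ => x j) hfx]
  simp [siteMeasure, Measure.map_const, hA]

/-- The map that sends the `j`-th Laguerre cell to the site `x j`; off the cells it takes the value
`x 0`, so that its range consists of sites. -/
noncomputable def laguerreMap [NeZero N] (x : Fin N → E d) (w : Fin N → ℝ) (y : E d) : E d :=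
  x 0 + ∑ j, (laguerreCell x w j).indicator (fun _ => x j - x 0) y

lemma laguerreMap_eq [NeZero N] {x : Fin N → E d} {w : Fin N → ℝ} {j : Fin N} {y : E d}
    (hy : y ∈ laguerreCell x w j) : laguerreMap x w y = x j := by
  rw [laguerreMap, Finset.sum_eq_single_of_mem j (Finset.mem_univ _) fun k _ hk =>
    indicator_of_notMem (fun h => hk (eq_of_mem_laguerreCell h hy)) _, indicator_of_mem hy]
  abel

lemma laguerreMap_mem_range [NeZero N] (x : Fin N → E d) (w : Fin N → ℝ) (y : E d) :
    laguerreMap x w y ∈ range x := by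
  by_cases h : ∃ j, y ∈ laguerreCell x w j
  · obtain ⟨j, hj⟩ := h
    exact ⟨j, (laguerreMap_eq hj).symm⟩
  · push Not at h
    exact ⟨0, by simp [laguerreMap, h]⟩

lemma measurable_laguerreMap [NeZero N] (x : Fin N → E d) (w : Fin N → ℝ) :
    Measurable (laguerreMap x w) :=
  measurable_const.add (Finset.measurable_sum _ fun j _ =>
    measurable_const.indicator (measurableSet_laguerreCell x w j))

lemma Balanced.map_laguerreMap [NeZero N] [IsFiniteMeasure μ] (hac : μ ≪ volume)
    {x : Fin N → E d} (hx : Function.Injective x) {w : Fin N → ℝ} (hw : Balanced μ x w) :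
    μ.map (laguerreMap x w) = siteMeasure x :=
  map_eq_siteMeasure (sum_restrict_laguerreCell hac hx w) hw.measure_eq
    (measurable_laguerreMap x w).aemeasurable fun j => by
      filter_upwards [ae_restrict_mem (measurableSet_laguerreCell x w j)] with y hy
      exact laguerreMap_eq hy

/-- The weight of a site, as a function on the whole space that vanishes off the sites. -/
noncomputable def siteWeight (x : Fin N → E d) (w : Fin N → ℝ) (z : E d) : ℝ :=
  ∑ j, ({x j} : Set (E d)).indicator (fun _ => w j) z

lemma siteWeight_site {x : Fin N → E d} (hx : Function.Injective x) (w : Fin N → ℝ) (j : Fin N) :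
    siteWeight x w (x j) = w j := by
  have h : ∀ k ∈ Finset.univ, k ≠ j → ({x k} : Set (E d)).indicator (fun _ => w k) (x j) = 0 :=
    fun k _ hk => indicator_of_notMem (by simpa using fun h => hk (hx h).symm) _
  rw [siteWeight, Finset.sum_eq_single_of_mem j (Finset.mem_univ _) h]
  simp

lemma measurable_siteWeight (x : Fin N → E d) (w : Fin N → ℝ) : Measurable (siteWeight x w) :=
  Finset.measurable_sum _ fun _ _ => measurable_const.indicator (measurableSet_singleton _)

/-- The slack in the dual constraint at `(y, z)`: the amount by which the cost `‖y - z‖ ^ 2`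
exceeds the sum of the two Kantorovich potentials. -/
noncomputable def slack (x : Fin N → E d) (w : Fin N → ℝ) (p : E d × E d) : ℝ :=
  2 * (potential x w p.1 + siteWeight x w p.2 - inner ℝ p.2 p.1)

lemma slack_nonneg {x : Fin N → E d} (hx : Function.Injective x) (w : Fin N → ℝ) (y : E d)
    (j : Fin N) : 0 ≤ slack x w (y, x j) := by
  simp only [slack, siteWeight_site hx]
  linarith [le_potential x w y j]

lemma slack_eq_zero {x : Fin N → E d} (hx : Function.Injective x) {w : Fin N → ℝ} {y : E d}
    {j : Fin N} (hy : y ∈ laguerreCell x w j) : slack x w (y, x j) = 0 := by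
  simp only [slack, siteWeight_site hx, potential_eq_of_mem hy]
  ring

lemma eq_of_slack_eq_zero {x : Fin N → E d} (hx : Function.Injective x) {w : Fin N → ℝ} {y : E d}
    {j k : Fin N} (hy : y ∈ laguerreCell x w j) (h : slack x w (y, x k) = 0) : k = j := by
  simp only [slack, siteWeight_site hx] at h
  exact eq_of_mem_of_potential_eq hy (by linarith)

/-- The common value of the dual problem and of the transport problem. -/
noncomputable def dualValue (μ : Measure (E d)) (x : Fin N → E d) (w : Fin N → ℝ) : ℝ :=
  ∫ y, (‖y‖ ^ 2 - 2 * potential x w y) ∂μ +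
    ∫ z, (‖z‖ ^ 2 - 2 * siteWeight x w z) ∂(siteMeasure x)

variable {γ : Measure (E d × E d)}

lemma ae_of_fst_of_snd {x : Fin N → E d} (h1 : γ.fst = μ) (h2 : γ.snd = siteMeasure x)
    {p : E d → Prop} (hp : ∀ᵐ y ∂μ, p y) : ∀ᵐ q ∂γ, p q.1 ∧ ∃ j, q.2 = x j := by
  have a : ∀ᵐ q ∂γ, p q.1 := ae_of_ae_map measurable_fst.aemeasurable
    (by rwa [← Measure.fst, h1])
  have b : ∀ᵐ q ∂γ, ∃ j, q.2 = x j :=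
    ae_of_ae_map measurable_snd.aemeasurable (p := fun z => ∃ j, z = x j)
      (by rw [← Measure.snd, h2]; exact ae_siteMeasure_mem x)
  exact a.and b

lemma integrable_cost [IsProbabilityMeasure μ] {R : ℝ} (hR : ∀ᵐ y ∂μ, ‖y‖ ≤ R)
    {x : Fin N → E d} (h1 : γ.fst = μ) (h2 : γ.snd = siteMeasure x) :
    Integrable (fun p => ‖p.1 - p.2‖ ^ 2) γ := by
  have : IsFiniteMeasure γ := ⟨by rw [← Measure.fst_univ, h1]; exact measure_lt_top _ _⟩
  refine Integrable.of_bound (by fun_prop) ((R + ‖x‖) ^ 2) ?_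
  filter_upwards [ae_of_fst_of_snd h1 h2 hR] with p ⟨hp, j, hj⟩
  rw [Real.norm_eq_abs, abs_of_nonneg (by positivity)]
  gcongr
  exact (norm_sub_le _ _).trans (add_le_add hp (hj ▸ norm_le_pi_norm x j))

/-- The cost of a transport plan is the dual value plus the integral of the slack. -/
lemma integral_cost_eq [NeZero N] [IsProbabilityMeasure μ] {R : ℝ} (hR : ∀ᵐ y ∂μ, ‖y‖ ≤ R)
    (x : Fin N → E d) (w : Fin N → ℝ) (h1 : γ.fst = μ) (h2 : γ.snd = siteMeasure x) :
    Integrable (slack x w) γ ∧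
      ∫ p, ‖p.1 - p.2‖ ^ 2 ∂γ = dualValue μ x w + ∫ p, slack x w p ∂γ := by
  have i1 : Integrable (fun y => ‖y‖ ^ 2 - 2 * potential x w y) μ := by
    refine Integrable.sub ?_ ((integrable_potential hR x w).const_mul 2)
    refine Integrable.of_bound (by fun_prop) (R ^ 2) ?_
    filter_upwards [hR] with y hy
    rw [Real.norm_eq_abs, abs_of_nonneg (by positivity)]
    gcongr
  have i2 : Integrable (fun z => ‖z‖ ^ 2 - 2 * siteWeight x w z) (siteMeasure x) := by
    have hm := measurable_siteWeight x w
    refine Integrable.of_bound (by fun_prop)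
      (∑ j, |‖x j‖ ^ 2 - 2 * siteWeight x w (x j)|) ?_
    filter_upwards [ae_siteMeasure_mem x] with z ⟨j, hj⟩
    rw [hj]
    exact Finset.single_le_sum (f := fun j => |‖x j‖ ^ 2 - 2 * siteWeight x w (x j)|)
      (fun _ _ => abs_nonneg _) (Finset.mem_univ j)
  have m1 : MeasurePreserving Prod.fst γ μ := ⟨measurable_fst, h1⟩
  have m2 : MeasurePreserving Prod.snd γ (siteMeasure x) := ⟨measurable_snd, h2⟩
  have j1 := m1.integrable_comp_of_integrable i1
  have j2 := m2.integrable_comp_of_integrable i2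
  have hs : slack x w = fun p => ‖p.1 - p.2‖ ^ 2 - ((‖p.1‖ ^ 2 - 2 * potential x w p.1) +
      (‖p.2‖ ^ 2 - 2 * siteWeight x w p.2)) := by
    ext p
    rw [norm_sub_sq_real, slack, real_inner_comm]
    ring
  have ic := integrable_cost hR h1 h2
  refine ⟨hs ▸ ic.sub (j1.add j2), ?_⟩
  have k1 : ∫ y, (‖y‖ ^ 2 - 2 * potential x w y) ∂μ =
      ∫ p, (‖p.1‖ ^ 2 - 2 * potential x w p.1) ∂γ := by
    rw [← h1, Measure.fst, integral_map measurable_fst.aemeasurable]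
    rw [← Measure.fst, h1]; exact i1.aestronglyMeasurable
  have k2 : ∫ z, (‖z‖ ^ 2 - 2 * siteWeight x w z) ∂(siteMeasure x) =
      ∫ p, (‖p.2‖ ^ 2 - 2 * siteWeight x w p.2) ∂γ := by
    rw [← h2, Measure.snd, integral_map measurable_snd.aemeasurable]
    rw [← Measure.snd, h2]; exact i2.aestronglyMeasurable
  rw [dualValue, k1, k2, hs]
  have e := integral_sub ic (j1.add j2)
  have e' := integral_add j1 j2
  simp only [Function.comp_def, Pi.add_apply] at e e'
  rw [e, e']
  ring

lemma dualValue_le [NeZero N] [IsProbabilityMeasure μ] {R : ℝ} (hR : ∀ᵐ y ∂μ, ‖y‖ ≤ R)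
    {x : Fin N → E d} (hx : Function.Injective x) (w : Fin N → ℝ) (h1 : γ.fst = μ)
    (h2 : γ.snd = siteMeasure x) : dualValue μ x w ≤ ∫ p, ‖p.1 - p.2‖ ^ 2 ∂γ := by
  rw [(integral_cost_eq hR x w h1 h2).2, le_add_iff_nonneg_right]
  refine integral_nonneg_of_ae ?_
  filter_upwards [ae_of_fst_of_snd h1 h2 (Eventually.of_forall fun _ => trivial)] with p ⟨_, j, hj⟩
  have := slack_nonneg hx w p.1 j
  rwa [← hj] at this

/-- The pair `(S, T)` is a transport plan without slack if `T` is `x j` where `S` is in the `j`-th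
cell. -/
lemma integral_cost_eq_dualValue [NeZero N] [IsProbabilityMeasure μ] {R : ℝ}
    (hR : ∀ᵐ y ∂μ, ‖y‖ ≤ R) {x : Fin N → E d} (hx : Function.Injective x) (w : Fin N → ℝ)
    {S T : E d → E d} (hS : AEMeasurable S μ) (hT : AEMeasurable T μ) (hSμ : μ.map S = μ)
    (hTμ : μ.map T = siteMeasure x)
    (h : ∀ᵐ y ∂μ, ∃ j, S y ∈ laguerreCell x w j ∧ T y = x j) :
    ∫ y, ‖S y - T y‖ ^ 2 ∂μ = dualValue μ x w := by
  have hST := hS.prodMk hT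
  have h1 : (μ.map fun y => (S y, T y)).fst = μ := by rw [Measure.fst_map_prodMk₀ hT, hSμ]
  have h2 : (μ.map fun y => (S y, T y)).snd = siteMeasure x := by
    rw [Measure.snd_map_prodMk₀ hS, hTμ]
  obtain ⟨hi, he⟩ := integral_cost_eq hR x w h1 h2
  rw [integral_map hST hi.aestronglyMeasurable, integral_map hST (by fun_prop)] at he
  rw [he, add_eq_left]
  refine integral_eq_zero_of_ae ?_
  filter_upwards [h] with y ⟨j, hj, hTj⟩
  rw [hTj]
  exact slack_eq_zero hx hj

lemma dualValue_le_integral [NeZero N] [IsProbabilityMeasure μ] {R : ℝ}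
    (hR : ∀ᵐ y ∂μ, ‖y‖ ≤ R) {x : Fin N → E d} (hx : Function.Injective x) (w : Fin N → ℝ)
    {S T : E d → E d} (hS : AEMeasurable S μ) (hT : AEMeasurable T μ) (hSμ : μ.map S = μ)
    (hTμ : μ.map T = siteMeasure x) : dualValue μ x w ≤ ∫ y, ‖S y - T y‖ ^ 2 ∂μ := by
  have h1 : (μ.map fun y => (S y, T y)).fst = μ := by rw [Measure.fst_map_prodMk₀ hT, hSμ]
  have h2 : (μ.map fun y => (S y, T y)).snd = siteMeasure x := by
    rw [Measure.snd_map_prodMk₀ hS, hTμ]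
  have h := dualValue_le hR hx w h1 h2
  rwa [integral_map (hS.prodMk hT) (by fun_prop)] at h

lemma integral_cost_laguerreMap [NeZero N] [IsProbabilityMeasure μ] (hac : μ ≪ volume) {R : ℝ}
    (hR : ∀ᵐ y ∂μ, ‖y‖ ≤ R) {x : Fin N → E d} (hx : Function.Injective x) {w : Fin N → ℝ}
    (hw : Balanced μ x w) : ∫ y, ‖y - laguerreMap x w y‖ ^ 2 ∂μ = dualValue μ x w := by
  refine integral_cost_eq_dualValue hR hx w aemeasurable_id
    (measurable_laguerreMap x w).aemeasurable Measure.map_id (hw.map_laguerreMap hac hx) ?_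
  filter_upwards [ae_mem_laguerreCell hac hx w] with y ⟨j, hj⟩
  exact ⟨j, hj, laguerreMap_eq hj⟩

lemma lintegral_cost_map [IsProbabilityMeasure μ] {R : ℝ} (hR : ∀ᵐ y ∂μ, ‖y‖ ≤ R)
    {x : Fin N → E d} {T : E d → E d} (hT : Measurable T) (hTμ : μ.map T = siteMeasure x) :
    ∫⁻ y, ‖y - T y‖ₑ ^ 2 ∂μ = ENNReal.ofReal (∫ y, ‖y - T y‖ ^ 2 ∂μ) := by
  refine lintegral_enorm_sq ?_
  have h := integrable_cost (γ := μ.map fun y => (y, T y)) hR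
    (by rw [Measure.fst_map_prodMk hT, Measure.map_id'])
    (by rw [Measure.snd_map_prodMk measurable_id', hTμ])
  rwa [integrable_map_measure (by fun_prop) (by fun_prop)] at h

lemma Balanced.isOptimalTransportMap [NeZero N] [IsProbabilityMeasure μ] (hac : μ ≪ volume)
    {R : ℝ} (hR : ∀ᵐ y ∂μ, ‖y‖ ≤ R) {x : Fin N → E d} (hx : Function.Injective x)
    {w : Fin N → ℝ} (hw : Balanced μ x w) :
    IsOptimalTransportMap μ (siteMeasure x) (laguerreMap x w) := by
  have hT := measurable_laguerreMap x w
  have hTμ := hw.map_laguerreMap hac hx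
  refine ⟨hT, hTμ, fun γ h1 h2 => ?_⟩
  rw [lintegral_cost_map hR hT hTμ, integral_cost_laguerreMap hac hR hx hw,
    lintegral_enorm_sq (integrable_cost hR h1 h2)]
  exact ENNReal.ofReal_le_ofReal (dualValue_le hR hx w h1 h2)

/-- Every optimal map sends almost every point of a balanced Laguerre cell to its site, because
its plan has no slack. -/
lemma IsOptimalTransportMap.ae_eq_site [NeZero N] [IsProbabilityMeasure μ] (hac : μ ≪ volume)
    {R : ℝ} (hR : ∀ᵐ y ∂μ, ‖y‖ ≤ R) {x : Fin N → E d} (hx : Function.Injective x)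
    {w : Fin N → ℝ} (hw : Balanced μ x w) {T : E d → E d}
    (hT : IsOptimalTransportMap μ (siteMeasure x) T) :
    ∀ᵐ y ∂μ, ∀ j, y ∈ laguerreCell x w j → T y = x j := by
  obtain ⟨hTm, hTμ, hopt⟩ := hT
  have g1 : (μ.map fun y => (y, T y)).fst = μ := by
    rw [Measure.fst_map_prodMk hTm, Measure.map_id']
  have g2 : (μ.map fun y => (y, T y)).snd = siteMeasure x := by
    rw [Measure.snd_map_prodMk measurable_id', hTμ]
  have hL := hw.map_laguerreMap hac hx
  have hLm := measurable_laguerreMap x w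
  have h := hopt (μ.map fun y => (y, laguerreMap x w y))
    (by rw [Measure.fst_map_prodMk hLm, Measure.map_id'])
    (by rw [Measure.snd_map_prodMk measurable_id', hL])
  rw [lintegral_map (by fun_prop) (by fun_prop)] at h
  simp only at h
  rw [lintegral_cost_map hR hTm hTμ, lintegral_cost_map hR hLm hL,
    ENNReal.ofReal_le_ofReal_iff (integral_nonneg fun _ => by positivity),
    integral_cost_laguerreMap hac hR hx hw] at h
  obtain ⟨hi, he⟩ := integral_cost_eq hR x w g1 g2
  have hm : Measurable fun y => (y, T y) := by fun_prop
  have hi' := hi.comp_measurable hm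
  rw [integral_map hm.aemeasurable hi.aestronglyMeasurable,
    integral_map hm.aemeasurable (by fun_prop)] at he
  have hrange : ∀ᵐ y ∂μ, ∃ j, T y = x j :=
    ae_of_ae_map hTm.aemeasurable (p := fun z => ∃ j, z = x j) (hTμ ▸ ae_siteMeasure_mem x)
  have hnn : 0 ≤ᵐ[μ] fun y => slack x w (y, T y) := by
    filter_upwards [hrange] with y ⟨j, hj⟩
    rw [hj]
    exact slack_nonneg hx w y j
  have hz : ∫ y, slack x w (y, T y) ∂μ = 0 :=
    le_antisymm (by linarith) (integral_nonneg_of_ae hnn)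
  filter_upwards [hrange, (integral_eq_zero_iff_of_nonneg_ae hnn hi').1 hz] with y ⟨k, hk⟩ hy j hj
  simp only [hk, Pi.zero_apply] at hy
  rw [hk, eq_of_slack_eq_zero hx hj hy]

lemma IsOptimalTransportMap.ae_eq [NeZero N] [IsProbabilityMeasure μ] (hac : μ ≪ volume)
    {R : ℝ} (hR : ∀ᵐ y ∂μ, ‖y‖ ≤ R) {x : Fin N → E d} (hx : Function.Injective x)
    {T T' : E d → E d} (hT : IsOptimalTransportMap μ (siteMeasure x) T)
    (hT' : IsOptimalTransportMap μ (siteMeasure x) T') : T =ᵐ[μ] T' := by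
  obtain ⟨w, hw⟩ := exists_balanced hac hR hx
  filter_upwards [ae_mem_laguerreCell hac hx w, hT.ae_eq_site hac hR hx hw,
    hT'.ae_eq_site hac hR hx hw] with y ⟨j, hj⟩ h h'
  rw [h j hj, h' j hj]

lemma IsOptimalTransportMap.preimage_ae_eq [NeZero N] [IsProbabilityMeasure μ] (hac : μ ≪ volume)
    {R : ℝ} (hR : ∀ᵐ y ∂μ, ‖y‖ ≤ R) {x : Fin N → E d} (hx : Function.Injective x)
    {w : Fin N → ℝ} (hw : Balanced μ x w) {T : E d → E d}
    (hT : IsOptimalTransportMap μ (siteMeasure x) T) (j : Fin N) :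
    T ⁻¹' {x j} =ᵐ[μ] laguerreCell x w j := by
  filter_upwards [ae_mem_laguerreCell hac hx w, hT.ae_eq_site hac hR hx hw] with y ⟨k, hk⟩ h
  refine propext ⟨fun hy => ?_, fun hy => h j hy⟩
  have hkj : k = j := hx ((h k hk).symm.trans hy)
  exact hkj ▸ hk

lemma Balanced.laguerreCell_ae_eq [NeZero N] [IsProbabilityMeasure μ] (hac : μ ≪ volume)
    {R : ℝ} (hR : ∀ᵐ y ∂μ, ‖y‖ ≤ R) {x : Fin N → E d} (hx : Function.Injective x)
    {w w' : Fin N → ℝ} (hw : Balanced μ x w) (hw' : Balanced μ x w') (j : Fin N) :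
    laguerreCell x w j =ᵐ[μ] laguerreCell x w' j :=
  have hT := hw.isOptimalTransportMap hac hR hx
  (hT.preimage_ae_eq hac hR hx hw j).symm.trans (hT.preimage_ae_eq hac hR hx hw' j)

/-! ### Dependence of the balanced cells on the sites, and rearrangements onto them -/

lemma isOpen_setOf_injective : IsOpen {x : Fin N → E d | Function.Injective x} := by
  have he : {x : Fin N → E d | Function.Injective x} =
      ⋂ i, ⋂ k, ⋂ (_ : i ≠ k), {x | x i ≠ x k} := by
    ext x; simp [Function.Injective, not_imp_not]
  rw [he]
  exact isOpen_iInter_of_finite fun i => isOpen_iInter_of_finite fun k =>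
    isOpen_iInter_of_finite fun _ => isOpen_ne_fun (by fun_prop) (by fun_prop)

lemma balanced_of_tendsto [NeZero N] [IsFiniteMeasure μ] (hac : μ ≪ volume) {x : Fin N → E d}
    (hx : Function.Injective x) {w : Fin N → ℝ} {α : Type*} {l : Filter α} [l.NeBot]
    {p : α → (Fin N → E d) × (Fin N → ℝ)} (hp : Tendsto p l (𝓝 (x, w)))
    (hb : ∀ᶠ a in l, Balanced μ (p a).1 (p a).2) : Balanced μ x w := by
  intro i
  have h := (continuousAt_setIntegral_laguerreCell hac hx w (integrable_const (1 : ℝ))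
    i).tendsto.comp hp
  simp only [Function.comp_def, setIntegral_const, smul_eq_mul, mul_one] at h
  refine tendsto_nhds_unique h (tendsto_const_nhds.congr' ?_)
  filter_upwards [hb] with a ha
  exact (ha i).symm

/-- The integral of a function over the balanced Laguerre cells depends continuously on the
sites: by compactness of the normalized balanced weights and since the balanced cells do not
depend on the choice of the weights. -/
lemma continuousAt_setIntegral_balanced [NeZero N] [IsProbabilityMeasure μ] (hac : μ ≪ volume)
    {R : ℝ} (hR : ∀ᵐ y ∂μ, ‖y‖ ≤ R) {W : (Fin N → E d) → Fin N → ℝ}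
    (hW : ∀ x, Function.Injective x → Balanced μ x (W x) ∧ ‖W x‖ ≤ 2 * (‖x‖ * R))
    {F : Type*} [NormedAddCommGroup F] [NormedSpace ℝ F] {g : E d → F} (hg : Integrable g μ)
    {x : Fin N → E d} (hx : Function.Injective x) (j : Fin N) :
    ContinuousAt (fun x => ∫ y in laguerreCell x (W x) j, g y ∂μ) x := by
  have hR0 := nonneg_of_ae_norm_le hR
  have hinj : ∀ᶠ x' in 𝓝 x, Function.Injective x' :=
    isOpen_setOf_injective.mem_nhds hx
  refine tendsto_iff_ultrafilter _ _ _ |>.2 fun U hU => ?_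
  have hWb : ∀ᶠ x' in (U : Filter (Fin N → E d)),
      W x' ∈ Metric.closedBall (0 : Fin N → ℝ) (2 * ((‖x‖ + 1) * R)) := by
    have hn : ∀ᶠ x' in 𝓝 x, ‖x'‖ < ‖x‖ + 1 :=
      continuous_norm.continuousAt.eventually_lt_const (lt_add_one _)
    filter_upwards [hinj.filter_mono hU, hn.filter_mono hU] with x' h1 h2
    rw [mem_closedBall_zero_iff]
    refine (hW x' h1).2.trans ?_
    gcongr
  obtain ⟨w, -, hw⟩ := (isCompact_closedBall (0 : Fin N → ℝ)
    (2 * ((‖x‖ + 1) * R))).ultrafilter_le_nhds (U.map W)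
    (le_principal_iff.2 (Ultrafilter.mem_map.2 hWb))
  have hp : Tendsto (fun x' => (x', W x')) U (𝓝 (x, w)) :=
    Tendsto.prodMk_nhds hU hw
  have hbal : Balanced μ x w :=
    balanced_of_tendsto hac hx hp ((hinj.filter_mono hU).mono fun x' hx' => (hW x' hx').1)
  have he : ∫ y in laguerreCell x (W x) j, g y ∂μ = ∫ y in laguerreCell x w j, g y ∂μ :=
    setIntegral_congr_set ((hW x hx).1.laguerreCell_ae_eq hac hR hx hbal j)
  have h := (continuousAt_setIntegral_laguerreCell hac hx w hg j).tendsto.comp hp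
  exact (he ▸ h :)

/-- Pieces of equal mass are carried to the Laguerre cells by a measure preserving map. -/
lemma Balanced.exists_measurePreserving [NeZero N] [IsProbabilityMeasure μ] (hac : μ ≪ volume)
    {x : Fin N → E d} (hx : Function.Injective x) {w : Fin N → ℝ} (hw : Balanced μ x w)
    {A : Fin N → Set (E d)} (hAm : ∀ j, MeasurableSet (A j))
    (hd : Pairwise fun j k => AEDisjoint μ (A j) (A k)) (hcov : ∀ᵐ y ∂μ, ∃ j, y ∈ A j)
    (hA : ∀ j, μ (A j) = (N : ℝ≥0∞)⁻¹) :
    ∃ s : E d → E d, MeasurePreserving s μ μ ∧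
      ∀ j, (μ.restrict (A j)).map s = μ.restrict (laguerreCell x w j) := by
  have h : ∀ j, ∃ f : E d → E d, Measurable f ∧
      (μ.restrict (A j)).map f = μ.restrict (laguerreCell x w j) := fun j =>
    exists_map_eq _ _ (Measure.restrict_le_self.absolutelyContinuous.trans hac)
      (by simp [hA, hw.measure_eq])
  choose f hf hfA using h
  have hs : Measurable fun y => ∑ j, (A j).indicator (f j) y :=
    Finset.measurable_sum _ fun j _ => (hf j).indicator (hAm j)
  have hsf := sum_indicator_ae_eq hAm hd f
  refine ⟨_, ⟨hs, ?_⟩, fun j => ?_⟩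
  · rw [map_eq_sum_of_piecewise (sum_restrict_eq hAm hd hcov) hs.aemeasurable hsf]
    simp only [hfA]
    exact sum_restrict_laguerreCell hac hx w
  · rw [Measure.map_congr (hsf j), hfA]

end Transport

/-! ### Differentiability of functions with a given gradient field -/

/-- A function that is touched from above at each point of an open set by a quadratic function with
gradient `g m` is differentiable wherever `g` is continuous, with gradient `g`. -/
lemma hasGradientAt_of_le_add_sq {H : Type*} [NormedAddCommGroup H] [InnerProductSpace ℝ H]
    [CompleteSpace H] {f : H → ℝ} {g : H → H} {U : Set H} (hU : IsOpen U)
    (h : ∀ m ∈ U, ∀ m', f m' ≤ f m + inner ℝ (g m) (m' - m) + ‖m' - m‖ ^ 2) {m : H} (hm : m ∈ U)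
    (hg : ContinuousAt g m) : HasGradientAt f (g m) m := by
  rw [hasGradientAt_iff_isLittleO, Asymptotics.isLittleO_iff]
  intro c hc
  have hlim : Tendsto (fun m' => ‖g m' - g m‖ + ‖m' - m‖) (𝓝 m) (𝓝 0) := by
    have h1 : ContinuousAt (fun m' => ‖g m' - g m‖ + ‖m' - m‖) m := by fun_prop
    simpa using h1.tendsto
  filter_upwards [hU.mem_nhds hm, hlim.eventually_lt_const hc] with m' hm' hlt
  have h1 := h m hm m'
  have h2 := h m' hm' m
  have h3 : inner ℝ (g m') (m - m') = - inner ℝ (g m) (m' - m) - inner ℝ (g m' - g m) (m' - m) := by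
    rw [← neg_sub m' m, inner_neg_right, inner_sub_left]
    ring
  have h4 := (le_abs_self _).trans (abs_real_inner_le_norm (g m' - g m) (m' - m))
  have h4' := neg_le_of_abs_le (abs_real_inner_le_norm (g m' - g m) (m' - m))
  rw [h3, norm_sub_rev m m'] at h2
  have h5 : (‖g m' - g m‖ + ‖m' - m‖) * ‖m' - m‖ ≤ c * ‖m' - m‖ := by gcongr
  have h6 : 0 ≤ ‖g m' - g m‖ * ‖m' - m‖ := by positivity
  rw [Real.norm_eq_abs, abs_le]
  constructor <;> nlinarith

lemma contDiffOn_one_of_hasGradientAt {H : Type*} [NormedAddCommGroup H] [InnerProductSpace ℝ H]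
    [CompleteSpace H] {f : H → ℝ} {g : H → H} {U : Set H} (hU : IsOpen U)
    (h : ∀ m ∈ U, HasGradientAt f (g m) m) (hg : ContinuousOn g U) : ContDiffOn ℝ 1 f U := by
  rw [← zero_add (1 : WithTop ℕ∞), contDiffOn_succ_iff_fderiv_of_isOpen hU]
  refine ⟨fun m hm => (h m hm).differentiableAt.differentiableWithinAt, by simp, ?_⟩
  rw [contDiffOn_zero]
  refine ((InnerProductSpace.toDual ℝ H).continuous.comp_continuousOn hg).congr fun m hm => ?_
  exact (h m hm).hasFDerivAt.fderiv

/-! ### Step maps -/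

variable {d N : ℕ} {X : Set (E d)}

lemma leb_absolutelyContinuous (X : Set (E d)) : leb X ≪ volume :=
  Measure.smul_absolutelyContinuous.trans Measure.restrict_le_self.absolutelyContinuous

lemma isProbabilityMeasure_leb (hX : IsCompact X) (hvol : volume X ≠ 0) :
    IsProbabilityMeasure (leb X) :=
  ⟨by simp [leb, ENNReal.inv_mul_cancel hvol hX.measure_lt_top.ne]⟩

lemma EquiPartition.measurableSet (P : EquiPartition X N) : MeasurableSet X := by
  rw [← P.iUnion_cell]
  exact MeasurableSet.iUnion P.measurableSet_cell

lemma ae_leb_mem (hX : MeasurableSet X) : ∀ᵐ y ∂(leb X), y ∈ X :=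
  Measure.smul_absolutelyContinuous.ae_le (ae_restrict_mem hX)

lemma exists_ae_leb_norm_le (hX : IsCompact X) : ∃ R, ∀ᵐ y ∂(leb X), ‖y‖ ≤ R := by
  obtain ⟨R, hR⟩ := hX.isBounded.exists_norm_le
  exact ⟨R, (ae_leb_mem hX.measurableSet).mono fun y hy => hR y hy⟩

section Partition

variable (P : EquiPartition X N)

lemma EquiPartition.neZero (P : EquiPartition X N) (hvol : volume X ≠ 0) : NeZero N := by
  refine ⟨?_⟩
  rintro rfl
  apply hvol
  rw [← P.iUnion_cell]
  simp

lemma EquiPartition.pairwise_aedisjoint :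
    Pairwise fun j k => AEDisjoint (leb X) (P.cell j) (P.cell k) := fun _ _ hjk =>
  leb_absolutelyContinuous X (P.aedisjoint hjk)

lemma EquiPartition.ae_mem : ∀ᵐ y ∂(leb X), ∃ j, y ∈ P.cell j := by
  filter_upwards [ae_leb_mem P.measurableSet] with y hy
  rwa [← P.iUnion_cell, mem_iUnion] at hy

lemma EquiPartition.sum_restrict : ∑ j, (leb X).restrict (P.cell j) = leb X :=
  sum_restrict_eq P.measurableSet_cell P.pairwise_aedisjoint P.ae_mem

lemma EquiPartition.ae_of_forall_cell {p : E d → Prop}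
    (h : ∀ j, ∀ᵐ y ∂((leb X).restrict (P.cell j)), p y) : ∀ᵐ y ∂(leb X), p y := by
  have h' := (ae_restrict_iUnion_iff (μ := leb X) P.cell p).2 h
  rwa [Measure.restrict_eq_self_of_ae_mem (by simpa using P.ae_mem)] at h'

variable {P}

lemma HasValueOn.setIntegral_eq {m : LTwo X} {j : Fin N} {v : E d} (h : HasValueOn P m j v) :
    ∫ y in P.cell j, m y ∂(leb X) = (N : ℝ)⁻¹ • v := by
  rw [integral_congr_ae h, setIntegral_const, measureReal_def, P.leb_cell]
  simp

lemma HasValueOn.eq_smul [NeZero N] {m : stepMaps P} {j : Fin N} {v : E d}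
    (h : HasValueOn P (m : LTwo X) j v) : v = (N : ℝ) • cellIntegral P m j := by
  have hi : cellIntegral P m j = (N : ℝ)⁻¹ • v := h.setIntegral_eq
  rw [hi, smul_smul, mul_inv_cancel₀ (by exact_mod_cast NeZero.ne N), one_smul]

lemma hasValueOn_smul_cellIntegral [NeZero N] (m : stepMaps P) (j : Fin N) :
    HasValueOn P (m : LTwo X) j ((N : ℝ) • cellIntegral P m j) := by
  obtain ⟨v, hv⟩ := m.2 j
  rwa [← hv.eq_smul]

variable (P)

lemma exists_stepMaps_hasValueOn (v : Fin N → E d) :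
    ∃ m : stepMaps P, ∀ j, HasValueOn P (m : LTwo X) j (v j) := by
  have h : MemLp (fun y => ∑ j, (P.cell j).indicator (fun _ => v j) y) 2 (leb X) :=
    memLp_finsetSum _ fun j _ =>
      memLp_indicator_const 2 (P.measurableSet_cell j) (v j) (Or.inr (leb_cell_ne_top P j))
  have hv : ∀ j, HasValueOn P h.toLp j (v j) := by
    intro j
    filter_upwards [sum_indicator_ae_eq P.measurableSet_cell P.pairwise_aedisjoint
      (fun j _ => v j) j, ae_restrict_of_ae h.coeFn_toLp] with y hy he
    rw [he, hy]
  exact ⟨⟨h.toLp, fun j => ⟨v j, hv j⟩⟩, hv⟩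

lemma cellIntegral_surjective [NeZero N] : Function.Surjective (cellIntegral P) := by
  intro b
  obtain ⟨m, hm⟩ := exists_stepMaps_hasValueOn P fun j => (N : ℝ) • b j
  refine ⟨m, funext fun j => ?_⟩
  have hN : (N : ℝ) ≠ 0 := by exact_mod_cast NeZero.ne N
  exact (smul_right_injective (E d) hN (hm j).eq_smul).symm

/-- The cell integrals, as linear coordinates on the space of step maps. -/
noncomputable def cellEquiv [NeZero N] : stepMaps P ≃L[ℝ] (Fin N → E d) :=
  (LinearEquiv.ofBijective (cellIntegral P)
    ⟨cellIntegral_injective P, cellIntegral_surjective P⟩).toContinuousLinearEquiv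

/-- The values of a step map on the cells. -/
noncomputable def cellValues (m : stepMaps P) (j : Fin N) : E d := (N : ℝ) • cellIntegral P m j

lemma continuous_cellValues [NeZero N] : Continuous (cellValues P) :=
  ((cellEquiv P).continuous.const_smul (N : ℝ) :)

variable {P}

lemma hasValueOn_iff [NeZero N] {m : stepMaps P} {j : Fin N} {v : E d} :
    HasValueOn P (m : LTwo X) j v ↔ v = cellValues P m j :=
  ⟨fun h => h.eq_smul, fun h => h ▸ hasValueOn_smul_cellIntegral m j⟩

lemma notMem_diagonal_iff [NeZero N] {m : stepMaps P} :
    m ∉ diagonal P ↔ Function.Injective (cellValues P m) := by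
  simp only [diagonal, mem_ofPred_eq, hasValueOn_iff]
  constructor
  · intro h j k hjk
    by_contra hne
    exact h ⟨j, k, hne, _, rfl, hjk⟩
  · rintro h ⟨j, k, hne, v, rfl, hv⟩
    exact hne (h hv)

lemma isOpen_compl_diagonal [NeZero N] : IsOpen (diagonal P)ᶜ := by
  have h : (diagonal P)ᶜ = cellValues P ⁻¹' {x | Function.Injective x} := by
    ext m
    exact notMem_diagonal_iff
  rw [h]
  exact isOpen_setOf_injective.preimage (continuous_cellValues P)

lemma map_stepMaps_eq [NeZero N] (m : stepMaps P) :
    (leb X).map (m : LTwo X) = siteMeasure (cellValues P m) :=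
  map_eq_siteMeasure P.sum_restrict P.leb_cell (Lp.aestronglyMeasurable _).aemeasurable
    fun _ => hasValueOn_iff.2 rfl

/-- The scalar product of a step map with any map is the sum of the scalar products of its values
with the cell integrals of that map. -/
lemma inner_stepMaps_eq_sum [NeZero N] (m : stepMaps P) (s : LTwo X) :
    inner ℝ (m : LTwo X) s =
      ∑ j, inner ℝ (cellValues P m j) (∫ y in P.cell j, s y ∂(leb X)) := by
  have hi : Integrable (fun y => inner ℝ ((m : LTwo X) y) (s y)) (leb X) :=
    L2.integrable_inner (m : LTwo X) s
  rw [L2.inner_def, ← congrArg (fun ρ => ∫ y, inner ℝ ((m : LTwo X) y) (s y) ∂ρ) P.sum_restrict,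
    integral_finsetSum_measure fun j _ => hi.restrict]
  refine Finset.sum_congr rfl fun j _ => ?_
  rw [← integral_inner (integrable_cell P j s)]
  refine integral_congr_ae ?_
  filter_upwards [hasValueOn_iff.2 (rfl : cellValues P m j = _)] with y hy
  rw [hy]

end Partition

/-! ### The distance to the measure preserving maps -/

lemma norm_sub_sq_eq_integral (f g : LTwo X) :
    ‖f - g‖ ^ 2 = ∫ y, ‖g y - f y‖ ^ 2 ∂(leb X) := by
  rw [← real_inner_self_eq_norm_sq, L2.inner_def]
  refine integral_congr_ae ?_
  filter_upwards [Lp.coeFn_sub f g] with y hy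
  rw [real_inner_self_eq_norm_sq, hy, Pi.sub_apply, norm_sub_rev]

lemma distSq_le (m : LTwo X) {s : LTwo X} (hs : s ∈ mpMaps X) : distSq X m ≤ ‖m - s‖ ^ 2 :=
  ciInf_le (f := fun s : mpMaps X => ‖m - (s : LTwo X)‖ ^ 2)
    ⟨0, by rintro _ ⟨s, rfl⟩; positivity⟩ ⟨s, hs⟩

lemma distSq_eq_infDist_sq (hne : (mpMaps X).Nonempty) (m : LTwo X) :
    distSq X m = Metric.infDist m (mpMaps X) ^ 2 := by
  have := hne.to_subtype
  apply le_antisymm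
  · have h0 : 0 ≤ distSq X m := le_ciInf fun s => by positivity
    rw [← Real.sqrt_le_left Metric.infDist_nonneg]
    refine (Metric.le_infDist hne).2 fun s hs => ?_
    rw [Real.sqrt_le_left dist_nonneg, dist_eq_norm]
    exact distSq_le m hs
  · refine le_ciInf fun s => ?_
    rw [← dist_eq_norm]
    gcongr
    · exact Metric.infDist_nonneg
    · exact Metric.infDist_le_dist_of_mem s.2

lemma memLp_of_measurePreserving {R : ℝ} [IsFiniteMeasure (leb X)]
    (hR : ∀ᵐ y ∂(leb X), ‖y‖ ≤ R) {s : E d → E d} (hs : MeasurePreserving s (leb X) (leb X)) :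
    MemLp s 2 (leb X) :=
  MemLp.of_bound hs.measurable.aestronglyMeasurable R
    (hs.quasiMeasurePreserving.ae hR)

lemma toLp_mem_mpMaps {s : E d → E d} (h : MemLp s 2 (leb X))
    (hs : MeasurePreserving s (leb X) (leb X)) : h.toLp ∈ mpMaps X :=
  ⟨(Lp.stronglyMeasurable _).measurable, by rw [Measure.map_congr h.coeFn_toLp, hs.map_eq]⟩

lemma ae_differentiableAt_distSqStep (P : EquiPartition X N) (hne : (mpMaps X).Nonempty) :
    ∀ᵐ m ∂(volume : Measure (stepMaps P)), DifferentiableAt ℝ (distSqStep P) m := by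
  have hl : LipschitzWith (1 * 1) fun m : stepMaps P => Metric.infDist (m : LTwo X) (mpMaps X) :=
    (Metric.lipschitz_infDist_pt (mpMaps X)).comp (stepMaps P).subtypeₗᵢ.lipschitz
  filter_upwards [hl.ae_differentiableAt] with m hm
  have he : distSqStep P = fun m : stepMaps P => Metric.infDist (m : LTwo X) (mpMaps X) ^ 2 :=
    funext fun m => distSq_eq_infDist_sq hne m
  rw [he]
  exact hm.pow 2

/-- A step map with distinct values has a nearest measure preserving map, which carries each cell
of the partition to the Laguerre cell of its value. -/
lemma exists_nearest (hX : IsCompact X) (hvol : volume X ≠ 0) [NeZero N] {P : EquiPartition X N}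
    {m : stepMaps P} (hm : Function.Injective (cellValues P m)) {w : Fin N → ℝ}
    (hw : Balanced (leb X) (cellValues P m) w) :
    ∃ s ∈ mpMaps X, distSqStep P m = ‖(m : LTwo X) - s‖ ^ 2 ∧
      ∀ j, ∫ y in P.cell j, s y ∂(leb X) = ∫ y in laguerreCell (cellValues P m) w j, y ∂(leb X) := by
  have := isProbabilityMeasure_leb hX hvol
  obtain ⟨R, hR⟩ := exists_ae_leb_norm_le hX
  have hac := leb_absolutelyContinuous X
  obtain ⟨s, hs, hsc⟩ := hw.exists_measurePreserving hac hm P.measurableSet_cell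
    P.pairwise_aedisjoint P.ae_mem P.leb_cell
  have hL := memLp_of_measurePreserving hR hs
  have hsm := toLp_mem_mpMaps hL hs
  have hmm : AEMeasurable (m : LTwo X) (leb X) := (Lp.aestronglyMeasurable _).aemeasurable
  refine ⟨hL.toLp, hsm, le_antisymm (distSq_le _ hsm) ?_, fun j => ?_⟩
  · have : Nonempty (mpMaps X) := ⟨_, hsm⟩
    refine le_ciInf fun t => ?_
    have hcell : ∀ᵐ y ∂(leb X), ∃ j, (hL.toLp s : LTwo X) y ∈ laguerreCell (cellValues P m) w j ∧
        (m : LTwo X) y = cellValues P m j := by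
      refine P.ae_of_forall_cell fun j => ?_
      have h1 : ∀ᵐ y ∂((leb X).restrict (P.cell j)), s y ∈ laguerreCell (cellValues P m) w j := by
        refine ae_of_ae_map hs.measurable.aemeasurable ?_
        rw [hsc]
        exact ae_restrict_mem (measurableSet_laguerreCell _ _ j)
      filter_upwards [h1, hasValueOn_iff.2 (rfl : cellValues P m j = _),
        ae_restrict_of_ae hL.coeFn_toLp] with y hy hmy he
      exact ⟨j, by rwa [he], hmy⟩
    rw [norm_sub_sq_eq_integral, norm_sub_sq_eq_integral,
      integral_cost_eq_dualValue hR hm w hsm.aemeasurable hmm hsm.map_eq (map_stepMaps_eq m) hcell]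
    exact dualValue_le_integral hR hm w t.2.aemeasurable hmm t.2.map_eq (map_stepMaps_eq m)
  · rw [integral_congr_ae (ae_restrict_of_ae hL.coeFn_toLp), ← hsc,
      integral_map hs.measurable.aemeasurable (by fun_prop)]

/-! ### The gradient -/

/-- The gradient of the squared distance at a step map with distinct values, for a choice `W` of
balanced weights: `2 * (m - k)`, where the step map `k` has the cell integrals of the measure
preserving map nearest to `m`. -/
noncomputable def gradField [NeZero N] (P : EquiPartition X N)
    (W : (Fin N → E d) → Fin N → ℝ) (m : stepMaps P) : stepMaps P :=
  (2 : ℝ) • (m - (cellEquiv P).symm fun j =>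
    ∫ y in laguerreCell (cellValues P m) (W (cellValues P m)) j, y ∂(leb X))

/-- Comparing the distance at `m'` with the distance from `m'` to the measure preserving map
nearest to `m` bounds it by a quadratic function of `m'`. -/
lemma distSqStep_le_add_sq (hX : IsCompact X) (hvol : volume X ≠ 0) [NeZero N]
    {P : EquiPartition X N} {W : (Fin N → E d) → Fin N → ℝ} {m : stepMaps P}
    (hm : Function.Injective (cellValues P m))
    (hW : Balanced (leb X) (cellValues P m) (W (cellValues P m))) (m' : stepMaps P) :
    distSqStep P m' ≤
      distSqStep P m + inner ℝ (gradField P W m) (m' - m) + ‖m' - m‖ ^ 2 := by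
  obtain ⟨s, hs, he, hc⟩ := exists_nearest hX hvol hm hW
  set b : Fin N → E d := fun j =>
    ∫ y in laguerreCell (cellValues P m) (W (cellValues P m)) j, y ∂(leb X) with hb
  set k : stepMaps P := (cellEquiv P).symm b with hk
  have hkb : ∀ j, ∫ y in P.cell j, (k : LTwo X) y ∂(leb X) = b j := fun j =>
    congrFun ((cellEquiv P).apply_symm_apply b) j
  -- `k` is the orthogonal projection of `s` to the step maps.
  have hproj : inner ℝ ((m' - m : stepMaps P) : LTwo X) s = inner ℝ (m' - m) k := by
    rw [Submodule.coe_inner, inner_stepMaps_eq_sum, inner_stepMaps_eq_sum]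
    simp only [hc, hkb, hb]
  have h1 : distSqStep P m' ≤ ‖(m' : LTwo X) - s‖ ^ 2 := distSq_le _ hs
  have h2 : (m' : LTwo X) - s = ((m' - m : stepMaps P) : LTwo X) + ((m : LTwo X) - s) := by
    push_cast; abel
  have h3 : inner ℝ (gradField P W m) (m' - m) =
      2 * inner ℝ ((m' - m : stepMaps P) : LTwo X) ((m : LTwo X) - s) := by
    have h : inner ℝ ((m' - m : stepMaps P) : LTwo X) ((m : LTwo X) - s) =
        inner ℝ (m' - m) (m - k) := by
      rw [inner_sub_right, hproj, ← Submodule.coe_inner, ← inner_sub_right]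
    rw [h, real_inner_comm (m - k)]
    exact real_inner_smul_left (m - k) (m' - m) 2
  rw [h2, norm_add_sq_real] at h1
  rw [he, h3]
  have h4 : ‖m' - m‖ = ‖((m' - m : stepMaps P) : LTwo X)‖ := rfl
  rw [h4]
  linarith

lemma continuousAt_gradField (hX : IsCompact X) (hvol : volume X ≠ 0) [NeZero N]
    {P : EquiPartition X N} {R : ℝ} (hR : ∀ᵐ y ∂(leb X), ‖y‖ ≤ R)
    {W : (Fin N → E d) → Fin N → ℝ}
    (hW : ∀ x, Function.Injective x → Balanced (leb X) x (W x) ∧ ‖W x‖ ≤ 2 * (‖x‖ * R))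
    {m : stepMaps P} (hm : Function.Injective (cellValues P m)) :
    ContinuousAt (gradField P W) m := by
  have := isProbabilityMeasure_leb hX hvol
  have hid : Integrable (fun y : E d => y) (leb X) :=
    Integrable.of_bound (by fun_prop) R hR
  refine (continuousAt_id.sub ((cellEquiv P).symm.continuous.continuousAt.comp
    (continuousAt_pi.2 fun j => ?_))).const_smul (2 : ℝ)
  exact ContinuousAt.comp (f := cellValues P)
    (continuousAt_setIntegral_balanced (leb_absolutelyContinuous X) hR hW hid hm j)
    (continuous_cellValues P).continuousAt

/-- The value of the gradient field on a cell, in terms of any optimal transport map. -/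
lemma hasValueOn_gradField (hX : IsCompact X) (hvol : volume X ≠ 0) [NeZero N]
    {P : EquiPartition X N} {W : (Fin N → E d) → Fin N → ℝ} {m : stepMaps P}
    (hm : Function.Injective (cellValues P m))
    (hW : Balanced (leb X) (cellValues P m) (W (cellValues P m))) {T : E d → E d}
    (hT : IsOptimalTransportMap (leb X) (siteMeasure (cellValues P m)) T) (j : Fin N) :
    HasValueOn P (gradField P W m : LTwo X) j
      ((2 : ℝ) • (cellValues P m j - bary X (T ⁻¹' {cellValues P m j}))) := by
  have := isProbabilityMeasure_leb hX hvol
  obtain ⟨R, hR⟩ := exists_ae_leb_norm_le hX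
  have hpre := hT.preimage_ae_eq (leb_absolutelyContinuous X) hR hm hW j
  rw [hasValueOn_iff, bary, setIntegral_congr_set hpre, measureReal_congr hpre, hW j, inv_inv]
  set b : Fin N → E d := fun j =>
    ∫ y in laguerreCell (cellValues P m) (W (cellValues P m)) j, y ∂(leb X) with hb
  have hk : cellIntegral P ((cellEquiv P).symm b) j = b j :=
    congrFun ((cellEquiv P).apply_symm_apply b) j
  have hg : cellIntegral P (gradField P W m) j = (2 : ℝ) • (cellIntegral P m j - b j) := by
    rw [← hk, gradField, map_smul, map_sub]
    rfl
  have hv : cellValues P (gradField P W m) j = (N : ℝ) • (2 : ℝ) • (cellIntegral P m j - b j) := by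
    rw [← hg, cellValues]
  rw [hv, smul_comm, smul_sub (N : ℝ)]
  rfl

end VolPres

theorem mainTheorem6 {d N : ℕ} (X : Set (VolPres.E d)) (hX : IsCompact X)
    (hvol : volume X ≠ 0) (P : VolPres.EquiPartition X N) :
    (∀ᵐ m ∂(volume : Measure (VolPres.stepMaps P)),
        DifferentiableAt ℝ (VolPres.distSqStep P) m) ∧
    IsOpen (VolPres.diagonal P)ᶜ ∧
    ContDiffOn ℝ 1 (VolPres.distSqStep P) (VolPres.diagonal P)ᶜ ∧
    ∀ m : VolPres.stepMaps P, m ∉ VolPres.diagonal P →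
      ∀ x : Fin N → VolPres.E d, (∀ j, VolPres.HasValueOn P (m : VolPres.LTwo X) j (x j)) →
        (∃ T : VolPres.E d → VolPres.E d,
          VolPres.IsOptimalTransportMap (VolPres.leb X)
            ((VolPres.leb X).map (m : VolPres.LTwo X)) T ∧
          ∀ y ∈ X, T y ∈ Set.range x) ∧
        (∀ T T' : VolPres.E d → VolPres.E d,
          VolPres.IsOptimalTransportMap (VolPres.leb X)
            ((VolPres.leb X).map (m : VolPres.LTwo X)) T →
          VolPres.IsOptimalTransportMap (VolPres.leb X)
            ((VolPres.leb X).map (m : VolPres.LTwo X)) T' →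
          T =ᵐ[VolPres.leb X] T') ∧
        ∀ T : VolPres.E d → VolPres.E d,
          VolPres.IsOptimalTransportMap (VolPres.leb X)
            ((VolPres.leb X).map (m : VolPres.LTwo X)) T →
          ∃ G : VolPres.stepMaps P, HasGradientAt (VolPres.distSqStep P) G m ∧
            ∀ j, VolPres.HasValueOn P (G : VolPres.LTwo X) j
              ((2 : ℝ) • (x j - VolPres.bary X (T ⁻¹' {x j}))) := by
  have hprob := VolPres.isProbabilityMeasure_leb hX hvol
  have hN : NeZero N := P.neZero hvol
  obtain ⟨R, hR⟩ := VolPres.exists_ae_leb_norm_le hX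
  have hac := VolPres.leb_absolutelyContinuous X
  have hW : ∀ x : Fin N → VolPres.E d, ∃ w : Fin N → ℝ, Function.Injective x →
      VolPres.Balanced (VolPres.leb X) x w ∧ ‖w‖ ≤ 2 * (‖x‖ * R) := fun x => by
    by_cases hx : Function.Injective x
    · obtain ⟨w, hw⟩ := VolPres.exists_balanced_norm_le hac hR hx
      exact ⟨w, fun _ => hw⟩
    · exact ⟨0, fun h => absurd h hx⟩
  choose W hW using hW
  have hid := MeasurePreserving.id (VolPres.leb X)
  have hne : (VolPres.mpMaps X).Nonempty :=
    ⟨_, VolPres.toLp_mem_mpMaps (VolPres.memLp_of_measurePreserving hR hid) hid⟩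
  have hopen : IsOpen (VolPres.diagonal P)ᶜ := VolPres.isOpen_compl_diagonal
  have hcont : ∀ m ∈ (VolPres.diagonal P)ᶜ, ContinuousAt (VolPres.gradField P W) m :=
    fun m hm => VolPres.continuousAt_gradField hX hvol hR hW (VolPres.notMem_diagonal_iff.1 hm)
  have hgrad : ∀ m ∈ (VolPres.diagonal P)ᶜ,
      HasGradientAt (VolPres.distSqStep P) (VolPres.gradField P W m) m := fun m hm =>
    VolPres.hasGradientAt_of_le_add_sq hopen (fun m hm m' =>
      VolPres.distSqStep_le_add_sq hX hvol (VolPres.notMem_diagonal_iff.1 hm)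
        (hW _ (VolPres.notMem_diagonal_iff.1 hm)).1 m') hm (hcont m hm)
  refine ⟨VolPres.ae_differentiableAt_distSqStep P hne, hopen,
    VolPres.contDiffOn_one_of_hasGradientAt hopen hgrad
      fun m hm => (hcont m hm).continuousWithinAt, fun m hm x hx => ?_⟩
  obtain rfl : x = VolPres.cellValues P m := funext fun j => VolPres.hasValueOn_iff.1 (hx j)
  have hinj := VolPres.notMem_diagonal_iff.1 hm
  have hbal := (hW _ hinj).1
  rw [VolPres.map_stepMaps_eq]
  exact ⟨⟨_, hbal.isOptimalTransportMap hac hR hinj,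
      fun y _ => VolPres.laguerreMap_mem_range _ _ y⟩,
    fun T T' hT hT' => hT.ae_eq hac hR hinj hT',
    fun T hT => ⟨_, hgrad m hm, VolPres.hasValueOn_gradField hX hvol hinj hbal hT⟩⟩
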